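/- For $r\ge 0$ let $H^2_r$ be the real Hilbert space of functions $f(z)=\sum_{n\ge0}f_nz^n$, $|z|<1$, with real coefficients and $\|f\|_{H^2_r}^2=\sum_{n\ge0}(1+n)^{2r}|f_n|^2<\infty$. For $f\in H^2_{3/4}$ the series converges absolutely for $|z|\le1$, so that $f$ extends continuously to the closed unit disc. For $F\in L^1(\{|\zeta|=1\})$ put $$(P_+F)(z)=\frac1{2\pi i}\oint_{|\zeta|=1}\frac{F(\zeta)}{\zeta-z}\,d\zeta,\qquad |z|<1.$$ All square roots are principal branches. Let $\mathcal H$ be the space of real sequences $h=\{h_n\}_{n\ge0}$ such that $\sum_{n\ge0}h_nz^n=f(z)/\sqrt{1-z}$ for all $|z|<1$ with some $f\in H^2_{3/4}$ (necessarily unique), with the norm $\|h\|_{\mathcal H}=\|f\|_{H^2_{3/4}}$, and let $\mathcal H_0\subset\mathcal H$ consist of those $h$ for which $f(1)=0$. (i) The formula $(\mathcal Af)(z)=P_+\bigl[f(\zeta)/\sqrt{-\zeta}\,\bigr](z)$, $|z|<1$, defines a bounded linear bijection from $\{f\in H^2_{3/4}:f(1)=0\}$ onto $H^2_{3/4}$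 whose inverse is bounded. (ii) $\mathcal H_0$ is the set of all real sequences $h=\{h_n\}_{n\ge0}$ such that, for some $g\in H^2_{3/4}$, $$\sum_{n\ge0}h_nz^n=P_+\Bigl[\frac{g(\zeta)}{\sqrt{1-\overline\zeta}}\Bigr](z)\quad\text{for all }|z|<1 .$$ Moreover, there are absolute constants $C_1,C_2>0$ such that for every $g\in H^2_{3/4}$ the function $P_+[g(\zeta)/\sqrt{1-\overline\zeta}\,]$ is the generating function of some $h\in\mathcal H$ and $$C_1\|g\|_{H^2_{3/4}}\le\|h\|_{\mathcal H}\le C_2\|g\|_{H^2_{3/4}} .$$ -/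

import Mathlib

open scoped ComplexConjugate

noncomputable section

/-- The real weighted space `ℓ²_r = {c : ∑ (1 + n)^(2r) |c_n|² < ∞}`, as a linear space. -/
def ellTwo (r : ℝ) : Submodule ℝ (ℕ → ℝ) where
  carrier := {c | Summable fun n : ℕ => (1 + (n : ℝ)) ^ (2 * r) * |c n| ^ 2}
  zero_mem' := by simp [summable_zero]
  add_mem' := by
    intro a b ha hb
    refine Summable.of_nonneg_of_le (fun n => by positivity) (fun n => ?_)
      ((ha.mul_left 2).add (hb.mul_left 2))
    have hw : 0 ≤ (1 + (n : ℝ)) ^ (2 * r) := by positivity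
    have key : |(a + b) n| ^ 2 ≤ 2 * |a n| ^ 2 + 2 * |b n| ^ 2 := by
      simp only [sq_abs, Pi.add_apply]
      nlinarith [sq_nonneg (a n - b n)]
    calc (1 + (n : ℝ)) ^ (2 * r) * |(a + b) n| ^ 2
        ≤ (1 + (n : ℝ)) ^ (2 * r) * (2 * |a n| ^ 2 + 2 * |b n| ^ 2) :=
          mul_le_mul_of_nonneg_left key hw
      _ = _ := by ring
  smul_mem' := by
    intro k a ha
    refine (ha.mul_left (|k| ^ 2)).congr (fun n => ?_)
    simp only [Pi.smul_apply, smul_eq_mul, abs_mul]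
    ring

/-- The real Hardy–Sobolev space `H²_r` of functions `f(z) = ∑ f_n zⁿ` in the unit disc with
`{f_n} ∈ ℓ²_r`.  An element is given by its real Taylor coefficients; these are determined by the
values of `f` in the disc, see `HardySobolev.ext_of_disc`. -/
def HardySobolev (r : ℝ) : Type := ↥(ellTwo r)

namespace HardySobolev

instance (r : ℝ) : AddCommGroup (HardySobolev r) := inferInstanceAs (AddCommGroup ↥(ellTwo r))

instance (r : ℝ) : Module ℝ (HardySobolev r) := inferInstanceAs (Module ℝ ↥(ellTwo r))

/-- The Taylor coefficients `f_n` of `f`. -/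
def coeff {r : ℝ} (f : HardySobolev r) : ℕ → ℝ := Subtype.val f

/-- The value `f(z) = ∑ f_n zⁿ`.  For `r > 1/2` the series converges absolutely on the closed disc
`‖z‖ ≤ 1`, so that there `f` denotes the continuous extension of the function in the open disc. -/
def eval {r : ℝ} (f : HardySobolev r) (z : ℂ) : ℂ := ∑' n : ℕ, (f.coeff n : ℂ) * z ^ n

instance (r : ℝ) : CoeFun (HardySobolev r) (fun _ => ℂ → ℂ) := ⟨eval⟩

/-- `‖f‖² = ∑ (1 + n)^(2r) |f_n|²`. -/
instance (r : ℝ) : Norm (HardySobolev r) :=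
  ⟨fun f => Real.sqrt (∑' n : ℕ, (1 + (n : ℝ)) ^ (2 * r) * |f.coeff n| ^ 2)⟩

theorem norm_def {r : ℝ} (f : HardySobolev r) :
    ‖f‖ = Real.sqrt (∑' n : ℕ, (1 + (n : ℝ)) ^ (2 * r) * |f.coeff n| ^ 2) := rfl

theorem summable_weight {r : ℝ} (f : HardySobolev r) :
    Summable fun n : ℕ => (1 + (n : ℝ)) ^ (2 * r) * |f.coeff n| ^ 2 := f.2

@[simp] theorem coeff_add {r : ℝ} (f g : HardySobolev r) (n : ℕ) :
    (f + g).coeff n = f.coeff n + g.coeff n := rfl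

@[simp] theorem coeff_smul {r : ℝ} (k : ℝ) (f : HardySobolev r) (n : ℕ) :
    (k • f).coeff n = k * f.coeff n := rfl

@[simp] theorem coeff_zero {r : ℝ} (n : ℕ) : (0 : HardySobolev r).coeff n = 0 := rfl

theorem ext_coeff {r : ℝ} {f g : HardySobolev r} (h : ∀ n, f.coeff n = g.coeff n) : f = g :=
  Subtype.ext (funext h)

theorem weight_sq (r : ℝ) (n : ℕ) (x : ℝ) :
    (1 + (n : ℝ)) ^ (2 * r) * |x| ^ 2 = ((1 + (n : ℝ)) ^ r * x) ^ 2 := by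
  have h0 : (0 : ℝ) ≤ 1 + (n : ℝ) := by positivity
  rw [mul_comm 2 r, Real.rpow_mul h0, Real.rpow_two, sq_abs, mul_pow]

theorem norm_sq {r : ℝ} (f : HardySobolev r) :
    ‖f‖ ^ 2 = ∑' n : ℕ, (1 + (n : ℝ)) ^ (2 * r) * |f.coeff n| ^ 2 := by
  rw [norm_def, Real.sq_sqrt]
  exact tsum_nonneg fun n => by positivity

theorem summable_pair {r : ℝ} (f g : HardySobolev r) :
    Summable fun n : ℕ =>
      ((1 + (n : ℝ)) ^ r * f.coeff n) * ((1 + (n : ℝ)) ^ r * g.coeff n) := by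
  have hf := f.summable_weight
  have hg := g.summable_weight
  simp only [weight_sq] at hf hg
  refine Summable.of_norm_bounded (hf.add hg) (fun n => ?_)
  rw [Real.norm_eq_abs, abs_le]
  constructor <;>
    nlinarith [sq_nonneg ((1 + (n : ℝ)) ^ r * f.coeff n + (1 + (n : ℝ)) ^ r * g.coeff n),
      sq_nonneg ((1 + (n : ℝ)) ^ r * f.coeff n - (1 + (n : ℝ)) ^ r * g.coeff n)]

theorem core (r : ℝ) : NormedSpace.Core ℝ (HardySobolev r) where
  norm_nonneg f := Real.sqrt_nonneg _
  norm_smul k f := by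
    have h : ∀ n : ℕ, (1 + (n : ℝ)) ^ (2 * r) * |(k • f).coeff n| ^ 2 =
        k ^ 2 * ((1 + (n : ℝ)) ^ (2 * r) * |f.coeff n| ^ 2) := fun n => by
      rw [coeff_smul, abs_mul, mul_pow, sq_abs k]; ring
    simp only [norm_def, h, tsum_mul_left]
    rw [Real.sqrt_mul (sq_nonneg k), Real.sqrt_sq_eq_abs, Real.norm_eq_abs]
  norm_triangle f g := by
    have hf := f.summable_weight
    have hg := g.summable_weight
    have hfg := (f + g).summable_weight
    simp only [norm_def]
    simp only [weight_sq, coeff_add] at hf hg hfg ⊢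
    have := Real.Lp_add_le_tsum_of_nonneg (p := 2) one_le_two
      (f := fun n : ℕ => |(1 + (n : ℝ)) ^ r * f.coeff n|)
      (g := fun n : ℕ => |(1 + (n : ℝ)) ^ r * g.coeff n|)
      (fun _ => abs_nonneg _) (fun _ => abs_nonneg _)
      (by simpa only [Real.rpow_two, sq_abs] using hf)
      (by simpa only [Real.rpow_two, sq_abs] using hg)
    obtain ⟨hs, hle⟩ := this
    simp only [Real.rpow_two, sq_abs, ← Real.sqrt_eq_rpow] at hs hle
    refine le_trans (Real.sqrt_le_sqrt (hfg.tsum_le_tsum (fun n => ?_) hs)) hle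
    rw [mul_add, ← sq_abs]
    gcongr
    exact abs_add_le _ _
  norm_eq_zero_iff f := by
    constructor
    · intro h
      have h2 : ‖f‖ ^ 2 = 0 := by rw [h]; norm_num
      rw [norm_sq] at h2
      have h4 := f.summable_weight.hasSum
      rw [h2, hasSum_zero_iff_of_nonneg (fun n => by positivity)] at h4
      refine ext_coeff fun n => ?_
      have h3 := congrFun h4 n
      have hw : (1 + (n : ℝ)) ^ (2 * r) ≠ 0 := by positivity
      simpa [hw] using h3
    · rintro rfl
      simp [norm_def]

instance (r : ℝ) : NormedAddCommGroup (HardySobolev r) := NormedAddCommGroup.ofCore (core r)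

instance (r : ℝ) : NormedSpace ℝ (HardySobolev r) := NormedSpace.ofCore (core r)

/-- The Taylor coefficients of an element of `H²_{3/4}` are absolutely summable. -/
theorem summable_abs_coeff (f : HardySobolev (3 / 4)) : Summable fun n : ℕ => |f.coeff n| := by
  have h1 : Summable fun n : ℕ => (1 + (n : ℝ)) ^ (-(3 / 2) : ℝ) := by
    have h := (summable_nat_add_iff 1).2
      (Real.summable_nat_rpow.2 (show (-(3 / 2) : ℝ) < -1 by norm_num))
    refine h.congr fun n => ?_
    push_cast
    rw [add_comm]
  refine Summable.of_nonneg_of_le (fun n => abs_nonneg _) (fun n => ?_) (h1.add f.summable_weight)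
  have h0 : (0 : ℝ) < 1 + (n : ℝ) := by positivity
  rw [weight_sq]
  have e : (1 + (n : ℝ)) ^ (-(3 / 2) : ℝ) = ((1 + (n : ℝ)) ^ (-(3 / 4) : ℝ)) ^ 2 := by
    rw [← Real.rpow_two, ← Real.rpow_mul h0.le]; norm_num
  have e2 : (1 + (n : ℝ)) ^ (-(3 / 4) : ℝ) * (1 + (n : ℝ)) ^ (3 / 4 : ℝ) = 1 := by
    rw [← Real.rpow_add h0]; norm_num
  rw [e]
  set u := (1 + (n : ℝ)) ^ (-(3 / 4) : ℝ)
  set v := (1 + (n : ℝ)) ^ (3 / 4 : ℝ)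
  have e3 : |f.coeff n| = u * (v * |f.coeff n|) := by rw [← mul_assoc, e2, one_mul]
  have e4 : (v * f.coeff n) ^ 2 = (v * |f.coeff n|) ^ 2 := by rw [mul_pow, mul_pow, sq_abs]
  rw [e4, e3, ← mul_assoc v, mul_comm v u, e2, one_mul]
  nlinarith [sq_nonneg (u - v * |f.coeff n|), sq_nonneg (u + v * |f.coeff n|)]

theorem hasSum_of_norm_le_one (f : HardySobolev (3 / 4)) {z : ℂ} (hz : ‖z‖ ≤ 1) :
    HasSum (fun n : ℕ => (f.coeff n : ℂ) * z ^ n) (f z) := by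
  refine Summable.hasSum (Summable.of_norm_bounded f.summable_abs_coeff (fun n => ?_))
  rw [norm_mul, norm_pow, Complex.norm_real, Real.norm_eq_abs]
  exact mul_le_of_le_one_right (abs_nonneg _) (pow_le_one₀ (norm_nonneg _) hz)

/-- An element of `H²_{3/4}` is determined by its values in the open unit disc. -/
theorem ext_of_disc {f g : HardySobolev (3 / 4)} (h : ∀ z : ℂ, ‖z‖ < 1 → f z = g z) : f = g := by
  have key : ∀ f : HardySobolev (3 / 4), HasFPowerSeriesAt (fun z => f z)
      (FormalMultilinearSeries.ofScalars ℂ (fun n => (f.coeff n : ℂ))) 0 := fun f => by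
    rw [hasFPowerSeriesAt_iff]
    filter_upwards [Metric.ball_mem_nhds (0 : ℂ) one_pos] with z hz
    have := f.hasSum_of_norm_le_one (mem_ball_zero_iff.1 hz).le
    simpa [FormalMultilinearSeries.coeff_ofScalars, mul_comm] using this
  have he : (fun z => f z) =ᶠ[nhds 0] fun z => g z := by
    filter_upwards [Metric.ball_mem_nhds (0 : ℂ) one_pos] with z hz
    exact h z (mem_ball_zero_iff.1 hz)
  have hp := (key f).eq_formalMultilinearSeries_of_eventually (key g) he
  refine ext_coeff fun n => ?_
  have := congrArg (fun p => FormalMultilinearSeries.coeff p n) hp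
  simpa [FormalMultilinearSeries.coeff_ofScalars] using this

end HardySobolev

/-- The subspace `{f ∈ H²_{3/4} : f(1) = 0}`. -/
def HardySobolevZero : Submodule ℝ (HardySobolev (3 / 4)) where
  carrier := {f | f 1 = 0}
  zero_mem' := by simp [HardySobolev.eval]
  add_mem' := by
    intro a b ha hb
    have h := (a.hasSum_of_norm_le_one (z := 1) (by simp)).add
      (b.hasSum_of_norm_le_one (z := 1) (by simp))
    simp only [Set.mem_ofPred_eq] at ha hb ⊢
    rw [ha, hb, add_zero] at h
    rw [← h.tsum_eq]
    refine tsum_congr fun n => ?_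
    simp
  smul_mem' := by
    intro k a ha
    have h := (a.hasSum_of_norm_le_one (z := 1) (by simp)).mul_left (k : ℂ)
    simp only [Set.mem_ofPred_eq] at ha ⊢
    rw [ha, mul_zero] at h
    rw [← h.tsum_eq]
    refine tsum_congr fun n => ?_
    simp

/-- The principal branch of the square root (cut along the negative half-axis). -/
def csqrt (w : ℂ) : ℂ := w ^ (1 / 2 : ℂ)

/-- The projector `(P₊ F)(z) = (2πi)⁻¹ ∮_{|ζ| = 1} F(ζ) / (ζ - z) dζ`, for `|z| < 1`. -/
def Pplus (F : ℂ → ℂ) (z : ℂ) : ℂ :=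
  (2 * (Real.pi : ℂ) * Complex.I)⁻¹ * ∮ ζ in C(0, 1), F ζ / (ζ - z)

/-- `∑ h_n zⁿ ≡ F(z)` for `z` in the open unit disc. -/
def IsGeneratingFunction (h : ℕ → ℝ) (F : ℂ → ℂ) : Prop :=
  ∀ z : ℂ, ‖z‖ < 1 → HasSum (fun n : ℕ => (h n : ℂ) * z ^ n) (F z)

/-- The space of spectral data: real sequences `h` with `∑ h_n zⁿ ≡ f(z) / √(1 - z)` for some
`f ∈ H²_{3/4}`. -/
def calH : Set (ℕ → ℝ) :=
  {h | ∃ f : HardySobolev (3 / 4), IsGeneratingFunction h fun z => f z / csqrt (1 - z)}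

/-- The function `f ∈ H²_{3/4}` with `∑ h_n zⁿ ≡ f(z) / √(1 - z)`; it is unique, see
`calH.numerator_eq`. -/
def calH.numerator (h : calH) : HardySobolev (3 / 4) := Classical.choose h.2

theorem calH.numerator_eq (h : calH) (f : HardySobolev (3 / 4))
    (hf : IsGeneratingFunction h fun z => f z / csqrt (1 - z)) : calH.numerator h = f := by
  refine HardySobolev.ext_of_disc fun z hz => ?_
  have h1 := (Classical.choose_spec h.2 z hz).unique (hf z hz)
  have hne : csqrt (1 - z) ≠ 0 := by
    have hz1 : 1 - z ≠ 0 := by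
      intro h0
      rw [← sub_eq_zero.1 h0] at hz
      simp at hz
    simp [csqrt, Complex.cpow_eq_zero_iff, hz1]
  exact (div_left_inj' hne).1 h1

/-- The norm of the space of spectral data, `‖h‖ = ‖f‖_{H²_{3/4}}`. -/
def calH.norm (h : calH) : ℝ := ‖calH.numerator h‖

/-- The subspace of those `h` in the space of spectral data for which
`√(1 - z) ∑ h_n zⁿ |_{z = 1} = f(1) = 0`. -/
def calH0 : Set (ℕ → ℝ) := {h | ∃ hh : h ∈ calH, calH.numerator ⟨h, hh⟩ 1 = 0}

end

/-!
With respect to Taylor coefficients, `f ↦ P₊[f / √(-ζ)]` is the Toeplitz matrix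
`A_{mn} = 1 / (π (m - n + 1/2))`, because the right-hand side is the Fourier coefficient of
`1 / √(-ζ)` of index `m - n`. On the unit circle `-ζ = (1 - ζ) / (1 - conj ζ)`, and this
Wiener–Hopf factorization suggests the inverse `B g = √(1 - z) P₊[g / √(1 - conj ζ)]`. With
`b_n = 4⁻ⁿ (2n choose n)`, the coefficients of `1 / √(1 - z)`, its matrix has the closed form
`B_{mn} = b_m b_n (n + 1/2) / (n - m + 1/2)`.

Boundedness. If `∑ f_n = 0`, then `A` acts on `f` as the matrix `n / (π (m + 1/2) (m - n + 1/2))`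
(`reducedToeplitz`). After conjugation by the weight `(1 + n)^(3/4)` of `H²_{3/4}`, and up to bounded
diagonal factors (`b_n ≤ (1 + n)^(-1/2)`), the matrix `B` becomes
`((1 + m) / (1 + n))^(1/4) / (n - m + 1/2)`, and the reduced `A` becomes its transpose. This matrix
is bounded on `ℓ²` (`formBound_weighted_hilbert`): the discrete Hilbert matrix `1 / (n - m + 1/2)`
is, because its columns, continued to `m ∈ ℤ`, are orthogonal with bounded norms, and the difference
of the two passes the Schur test.

Inversion. The identities `B g (1) = 0`, `A B = 1` and `B A = 1` on `{f(1) = 0}` need only be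
checked on monomials. By partial fractions they reduce to the values of `∑ b_m / (m + x)` and of
its derivative at `x = 1/2 - k` (`tsum_invSqrtCoeff_cauchy`, `tsum_invSqrtCoeff_cauchy_sq`). These
follow from the contiguity relation of the Beta function `B(x, 1/2)` and the arcsine series at `1`.

Part (ii). The displacement identity `B_{m+1,n+1} - B_{mn} = a_{m+1} b_{n+1}`, with `a` the
coefficients of `√(1 - z)`, shows that the closed form of `B` is indeed the matrix of
`g ↦ √(1 - z) P₊[g / √(1 - conj ζ)]` (`inverseToeplitzOp_eval`). So `P₊[g / √(1 - conj ζ)]` is the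
generating function of the spectral data with numerator `B g`, and (ii) restates that `B` is an
isomorphism of `H²_{3/4}` onto `{f(1) = 0}`.
-/

/-! ### Matrices bounded on `ℓ²` -/

/-- The matrix `K` is bounded as a bilinear form on finitely supported sequences for the `ℓ²`
norm.  The bound is stated in the additive form `C (‖x‖² + ‖y‖²)`, which by homogeneity is
equivalent to `2 C ‖x‖ ‖y‖` and avoids square roots. -/
def FormBound (C : ℝ) (K : ℕ → ℕ → ℝ) : Prop :=
  ∀ (S T : Finset ℕ) (x y : ℕ → ℝ),
    |∑ m ∈ S, ∑ n ∈ T, x m * K m n * y n| ≤ C * (∑ m ∈ S, x m ^ 2 + ∑ n ∈ T, y n ^ 2)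

namespace FormBound

theorem transpose {C : ℝ} {K : ℕ → ℕ → ℝ} (h : FormBound C K) :
    FormBound C fun m n => K n m := by
  intro S T x y
  have := h T S y x
  rw [Finset.sum_comm, add_comm]
  refine le_of_eq_of_le ?_ this
  congr 1
  exact Finset.sum_congr rfl fun _ _ => Finset.sum_congr rfl fun _ _ => by ring

theorem add {C D : ℝ} {K L : ℕ → ℕ → ℝ} (hK : FormBound C K) (hL : FormBound D L) :
    FormBound (C + D) fun m n => K m n + L m n := by
  intro S T x y
  have e : ∑ m ∈ S, ∑ n ∈ T, x m * (K m n + L m n) * y n =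
      ∑ m ∈ S, ∑ n ∈ T, x m * K m n * y n + ∑ m ∈ S, ∑ n ∈ T, x m * L m n * y n := by
    simp only [← Finset.sum_add_distrib]
    exact Finset.sum_congr rfl fun _ _ => Finset.sum_congr rfl fun _ _ => by ring
  rw [e, add_mul]
  exact (abs_add_le _ _).trans (add_le_add (hK S T x y) (hL S T x y))

theorem diag_mul {C c : ℝ} {K : ℕ → ℕ → ℝ} (hC : 0 ≤ C) (hK : FormBound C K) {u v : ℕ → ℝ}
    (hu : ∀ n, |u n| ≤ c) (hv : ∀ n, |v n| ≤ c) :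
    FormBound (C * c ^ 2) fun m n => u m * K m n * v n := by
  intro S T x y
  have key : ∀ (w z : ℕ → ℝ), (∀ n, |w n| ≤ c) → ∀ R : Finset ℕ,
      ∑ n ∈ R, (w n * z n) ^ 2 ≤ c ^ 2 * ∑ n ∈ R, z n ^ 2 := by
    intro w z hw R
    rw [Finset.mul_sum]
    refine Finset.sum_le_sum fun n _ => ?_
    rw [mul_pow]
    gcongr ?_ * _
    exact sq_le_sq' (abs_le.1 (hw n)).1 (abs_le.1 (hw n)).2
  have e : ∑ m ∈ S, ∑ n ∈ T, x m * (u m * K m n * v n) * y n =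
      ∑ m ∈ S, ∑ n ∈ T, (u m * x m) * K m n * (v n * y n) :=
    Finset.sum_congr rfl fun _ _ => Finset.sum_congr rfl fun _ _ => by ring
  rw [e]
  refine (hK S T _ _).trans ?_
  rw [mul_assoc, mul_add (c ^ 2)]
  exact mul_le_mul_of_nonneg_left (add_le_add (key u x hu S) (key v y hv T)) hC

/-- The Schur test with the same weight `w` on both sides. -/
theorem of_schur {C : ℝ} {K R : ℕ → ℕ → ℝ} {w : ℕ → ℝ} (hw : ∀ n, 0 < w n)
    (hKR : ∀ m n, |K m n| ≤ R m n)
    (hrow : ∀ (T : Finset ℕ) m, ∑ n ∈ T, R m n * w n ≤ C * w m)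
    (hcol : ∀ (S : Finset ℕ) n, ∑ m ∈ S, R m n * w m ≤ C * w n) :
    FormBound C K := by
  intro S T x y
  have hR : ∀ m n, 0 ≤ R m n := fun m n => (abs_nonneg _).trans (hKR m n)
  have term : ∀ m n, |x m * K m n * y n| ≤
      x m ^ 2 / w m * (R m n * w n) + y n ^ 2 / w n * (R m n * w m) := by
    intro m n
    have h1 : |x m * K m n * y n| ≤ R m n * (|x m| * |y n|) := by
      rw [abs_mul, abs_mul]
      have := mul_le_mul_of_nonneg_right (hKR m n) (mul_nonneg (abs_nonneg (x m)) (abs_nonneg (y n)))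
      linarith
    have hm := hw m
    have hn := hw n
    have h2 : |x m| * |y n| ≤ x m ^ 2 / w m * w n + y n ^ 2 / w n * w m := by
      rw [← sq_abs (x m), ← sq_abs (y n), div_mul_eq_mul_div, div_mul_eq_mul_div,
        div_add_div _ _ hm.ne' hn.ne', le_div_iff₀ (mul_pos hm hn)]
      nlinarith [sq_nonneg (|x m| * w n - |y n| * w m),
        mul_nonneg (mul_nonneg (abs_nonneg (x m)) (abs_nonneg (y n))) (mul_pos hm hn).le]
    calc _ ≤ R m n * (|x m| * |y n|) := h1
      _ ≤ R m n * (x m ^ 2 / w m * w n + y n ^ 2 / w n * w m) :=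
        mul_le_mul_of_nonneg_left h2 (hR m n)
      _ = _ := by ring
  calc |∑ m ∈ S, ∑ n ∈ T, x m * K m n * y n|
      ≤ ∑ m ∈ S, ∑ n ∈ T, |x m * K m n * y n| :=
        (Finset.abs_sum_le_sum_abs _ _).trans
          (Finset.sum_le_sum fun _ _ => Finset.abs_sum_le_sum_abs _ _)
    _ ≤ ∑ m ∈ S, ∑ n ∈ T, (x m ^ 2 / w m * (R m n * w n) + y n ^ 2 / w n * (R m n * w m)) :=
        Finset.sum_le_sum fun _ _ => Finset.sum_le_sum fun _ _ => term _ _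
    _ = ∑ m ∈ S, x m ^ 2 / w m * ∑ n ∈ T, R m n * w n +
          ∑ n ∈ T, y n ^ 2 / w n * ∑ m ∈ S, R m n * w m := by
        simp only [Finset.sum_add_distrib, Finset.mul_sum]
        rw [Finset.sum_comm (s := S) (f := fun m n => y n ^ 2 / w n * (R m n * w m))]
    _ ≤ ∑ m ∈ S, C * x m ^ 2 + ∑ n ∈ T, C * y n ^ 2 := by
        refine add_le_add (Finset.sum_le_sum fun m _ => ?_) (Finset.sum_le_sum fun n _ => ?_)
        · have := mul_le_mul_of_nonneg_left (hrow T m) (div_nonneg (sq_nonneg (x m)) (hw m).le)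
          refine this.trans (le_of_eq ?_)
          field_simp [(hw m).ne']
        · have := mul_le_mul_of_nonneg_left (hcol S n) (div_nonneg (sq_nonneg (y n)) (hw n).le)
          refine this.trans (le_of_eq ?_)
          field_simp [(hw n).ne']
    _ = _ := by rw [← Finset.mul_sum, ← Finset.mul_sum, mul_add]

/-- Testing the form against `x = K y` bounds `K y` in `ℓ²`. -/
theorem sum_sq_le {C : ℝ} {K : ℕ → ℕ → ℝ} (hC : 0 < C) (h : FormBound C K) (S T : Finset ℕ)
    (y : ℕ → ℝ) : ∑ m ∈ S, (∑ n ∈ T, K m n * y n) ^ 2 ≤ 4 * C ^ 2 * ∑ n ∈ T, y n ^ 2 := by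
  have h1 := (le_abs_self _).trans (h S T (fun m => (∑ n ∈ T, K m n * y n) / (2 * C)) y)
  have e1 : ∑ m ∈ S, ∑ n ∈ T, (∑ n ∈ T, K m n * y n) / (2 * C) * K m n * y n =
      (∑ m ∈ S, (∑ n ∈ T, K m n * y n) ^ 2) / (2 * C) := by
    rw [Finset.sum_div]
    refine Finset.sum_congr rfl fun m _ => ?_
    simp only [mul_assoc, ← Finset.mul_sum]
    ring
  have e2 : ∑ m ∈ S, ((∑ n ∈ T, K m n * y n) / (2 * C)) ^ 2 =
      (∑ m ∈ S, (∑ n ∈ T, K m n * y n) ^ 2) / (2 * C) ^ 2 := by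
    rw [Finset.sum_div]
    exact Finset.sum_congr rfl fun m _ => div_pow _ _ _
  rw [e1, e2] at h1
  set X := ∑ m ∈ S, (∑ n ∈ T, K m n * y n) ^ 2
  set Y := ∑ n ∈ T, y n ^ 2
  have e3 : C * (X / (2 * C) ^ 2 + Y) = X / (4 * C) + C * Y := by field_simp; ring
  have e4 : X / (2 * C) = X / (4 * C) + X / (4 * C) := by field_simp; ring
  have e5 : X / (4 * C) ≤ C * Y := by linarith
  rw [div_le_iff₀ (by positivity)] at e5
  linarith

end FormBound

/-! ### The discrete Hilbert matrix -/

theorem half_integer_ne_zero (a b : ℕ) : (a : ℝ) - b + 1 / 2 ≠ 0 := by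
  intro h
  have h' : (2 * (a : ℤ) - 2 * b + 1 : ℤ) = 0 := by
    have : (2 * (a : ℝ) - 2 * b + 1) = 0 := by linarith
    exact_mod_cast this
  omega

/-- The sum over `-N ≤ m < N` of column `n` of `1 / (n - m + 1/2)`, evaluated by telescoping in
`n`; the second term under the sum is the entry at `m = -1 - i`. -/
theorem hilbert_column_sum (n N : ℕ) :
    ∑ i ∈ Finset.range N, (1 / ((n : ℝ) - i + 1 / 2) + 1 / ((n : ℝ) + i + 3 / 2)) =
      1 / ((N : ℝ) - 1 / 2) + 1 / ((N : ℝ) + 1 / 2) +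
        ∑ k ∈ Finset.range n, (1 / ((k : ℝ) + N + 3 / 2) - 1 / ((k : ℝ) + 3 / 2 - N)) := by
  have h1 : ∀ a b : ℕ, (a : ℝ) - b + 3 / 2 ≠ 0 := fun a b => by
    have := half_integer_ne_zero (a + 1) b
    push_cast at this
    convert this using 1
    ring
  have h2 : ∀ a b : ℕ, (a : ℝ) - b - 1 / 2 ≠ 0 := fun a b => by
    have := half_integer_ne_zero a (b + 1)
    push_cast at this
    convert this using 1
    ring
  induction n with
  | zero =>
    induction N with
    | zero => norm_num
    | succ N ih =>
      rw [Finset.sum_range_succ, ih]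
      simp only [Finset.range_zero, Finset.sum_empty]
      have e : 1 / (((0 : ℕ) : ℝ) - N + 1 / 2) = - (1 / ((N : ℝ) - 1 / 2)) := by
        rw [← one_div_neg_eq_neg_one_div]; congr 1; push_cast; ring
      rw [e]
      push_cast
      ring
  | succ n ih =>
    rw [Finset.sum_range_succ _ n, ← add_assoc, ← ih, ← sub_eq_iff_eq_add', ← Finset.sum_sub_distrib]
    have := Finset.sum_range_sub
      (fun i : ℕ => 1 / ((n : ℝ) + i + 3 / 2) - 1 / ((n : ℝ) + 3 / 2 - i)) N
    simp only [Nat.cast_zero] at this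
    rw [add_zero, sub_zero, sub_self, sub_zero] at this
    rw [← this]
    refine Finset.sum_congr rfl fun i _ => ?_
    push_cast
    ring

theorem tendsto_hilbert_column_sum (n : ℕ) :
    Filter.Tendsto (fun N : ℕ =>
      ∑ i ∈ Finset.range N, (1 / ((n : ℝ) - i + 1 / 2) + 1 / ((n : ℝ) + i + 3 / 2)))
      Filter.atTop (nhds 0) := by
  simp only [hilbert_column_sum]
  have hT : Filter.Tendsto (fun N : ℕ => (N : ℝ)) Filter.atTop Filter.atTop :=
    tendsto_natCast_atTop_atTop
  have h1 : ∀ c : ℝ, Filter.Tendsto (fun N : ℕ => 1 / ((N : ℝ) + c)) Filter.atTop (nhds 0) :=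
    fun c => by
      simp only [one_div]
      exact (Filter.tendsto_atTop_add_const_right _ c hT).inv_tendsto_atTop
  have h2 : Filter.Tendsto (fun N : ℕ => ∑ k ∈ Finset.range n,
      (1 / ((k : ℝ) + N + 3 / 2) - 1 / ((k : ℝ) + 3 / 2 - N))) Filter.atTop
      (nhds (∑ k ∈ Finset.range n, (0 : ℝ))) := by
    refine tendsto_finsetSum _ fun k _ => ?_
    have := (h1 (k + 3 / 2)).add (h1 (-(k + 3 / 2)))
    rw [add_zero] at this
    refine this.congr fun N => ?_
    rw [sub_eq_add_neg, ← one_div_neg_eq_neg_one_div]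
    ring_nf
  simpa [sub_eq_add_neg] using ((h1 (-(1 / 2))).add (h1 (1 / 2))).add h2

/-- Squared norms of the columns of `1 / (n - m + 1/2)` truncated to `-N ≤ m < N`: they decrease
in `n`, so the column `n = 0` decides. -/
theorem hilbert_diag_le (n N : ℕ) :
    ∑ i ∈ Finset.range N, (1 / ((n : ℝ) - i + 1 / 2) ^ 2 + 1 / ((n : ℝ) + i + 3 / 2) ^ 2) ≤ 64 := by
  induction n with
  | zero =>
    have h : ∀ N : ℕ, ∑ i ∈ Finset.range N,
        (1 / (((0 : ℕ) : ℝ) - i + 1 / 2) ^ 2 + 1 / (((0 : ℕ) : ℝ) + i + 3 / 2) ^ 2) ≤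
          64 - 64 / ((N : ℝ) + 1) := by
      intro N
      induction N with
      | zero => norm_num
      | succ N ih =>
        rw [Finset.sum_range_succ]
        have hsq : 0 < ((N : ℝ) - 1 / 2) ^ 2 := by
          have := half_integer_ne_zero 0 N
          have h' : (N : ℝ) - 1 / 2 ≠ 0 := by
            intro h0
            apply this
            push_cast
            linarith
          positivity
        -- Both new terms are compared with a multiple of the telescoping `1 / ((N + 1) (N + 2))`.
        have hq : ((N : ℝ) + 1) * (N + 2) ≤ 32 * ((N : ℝ) - 1 / 2) ^ 2 := by
          rcases N with _ | N
          · norm_num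
          · push_cast
            nlinarith [(Nat.cast_nonneg N : (0 : ℝ) ≤ N)]
        have t1 : 1 / (((0 : ℕ) : ℝ) - N + 1 / 2) ^ 2 ≤ 32 / (((N : ℝ) + 1) * (N + 2)) := by
          rw [div_le_div_iff₀ (by push_cast; nlinarith) (by positivity)]
          push_cast
          nlinarith
        have t2 : 1 / (((0 : ℕ) : ℝ) + N + 3 / 2) ^ 2 ≤ 32 / (((N : ℝ) + 1) * (N + 2)) := by
          rw [div_le_div_iff₀ (by positivity) (by positivity)]
          push_cast
          nlinarith [(Nat.cast_nonneg N : (0 : ℝ) ≤ N)]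
        have t3 : 64 / ((N : ℝ) + 1) - 64 / ((N : ℝ) + 1 + 1) =
            32 / (((N : ℝ) + 1) * (N + 2)) + 32 / (((N : ℝ) + 1) * (N + 2)) := by
          field_simp
          ring
        push_cast at ih t1 t2 ⊢
        linarith
    refine (h N).trans ?_
    have : 0 ≤ 64 / ((N : ℝ) + 1) := by positivity
    linarith
  | succ n ih =>
    refine le_trans ?_ ih
    rw [← sub_nonpos, ← Finset.sum_sub_distrib]
    have := Finset.sum_range_sub
      (fun i : ℕ => 1 / ((n : ℝ) + i + 3 / 2) ^ 2 - 1 / ((n : ℝ) + 3 / 2 - i) ^ 2) N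
    simp only [Nat.cast_zero] at this
    rw [add_zero, sub_zero, sub_self, sub_zero] at this
    have hle : 1 / ((n : ℝ) + N + 3 / 2) ^ 2 - 1 / ((n : ℝ) + 3 / 2 - N) ^ 2 ≤ 0 := by
      rw [sub_nonpos]
      have hne : ((n : ℝ) + 3 / 2 - N) ≠ 0 := by
        have := half_integer_ne_zero (n + 1) N
        push_cast at this
        intro h0
        apply this
        linarith
      apply one_div_le_one_div_of_le (by positivity)
      nlinarith [mul_nonneg (Nat.cast_nonneg n : (0 : ℝ) ≤ n) (Nat.cast_nonneg N : (0 : ℝ) ≤ N),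
        (Nat.cast_nonneg N : (0 : ℝ) ≤ N)]
    refine le_of_eq_of_le ?_ hle
    rw [← this]
    refine Finset.sum_congr rfl fun i _ => ?_
    push_cast
    ring

/-- The columns of the two-sided matrix `1 / (n - m + 1/2)`, `m ∈ ℤ`, are orthogonal, so it is a
multiple of an isometry; this bounds its restriction to `m ≥ 0`.  Negative indices `m = -1 - i`
are accounted for by the second family of terms. -/
theorem hilbert_sum_sq_le (S T : Finset ℕ) (y : ℕ → ℝ) :
    ∑ m ∈ S, (∑ n ∈ T, 1 / ((n : ℝ) - m + 1 / 2) * y n) ^ 2 ≤ 64 * ∑ n ∈ T, y n ^ 2 := by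
  set E : ℕ → ℕ → ℕ → ℝ := fun N n k => ∑ i ∈ Finset.range N,
    (1 / ((n : ℝ) - i + 1 / 2) * (1 / ((k : ℝ) - i + 1 / 2)) +
      1 / ((n : ℝ) + i + 3 / 2) * (1 / ((k : ℝ) + i + 3 / 2))) with hE
  have hoff : ∀ n k : ℕ, n ≠ k →
      Filter.Tendsto (fun N => E N n k) Filter.atTop (nhds 0) := by
    intro n k hnk
    have hnk' : (n : ℝ) - k ≠ 0 := by
      rw [sub_ne_zero]
      exact_mod_cast hnk
    have := ((tendsto_hilbert_column_sum k).sub (tendsto_hilbert_column_sum n)).div_const ((n : ℝ) - k)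
    rw [sub_zero, zero_div] at this
    refine this.congr fun N => ?_
    rw [← Finset.sum_sub_distrib, Finset.sum_div]
    refine Finset.sum_congr rfl fun i _ => ?_
    have a1 := half_integer_ne_zero n i
    have a2 := half_integer_ne_zero k i
    have a3 : (n : ℝ) + i + 3 / 2 ≠ 0 := by positivity
    have a4 : (k : ℝ) + i + 3 / 2 ≠ 0 := by positivity
    have s1 : 1 / ((k : ℝ) - i + 1 / 2) - 1 / ((n : ℝ) - i + 1 / 2) =
        ((n : ℝ) - k) * (1 / ((n : ℝ) - i + 1 / 2) * (1 / ((k : ℝ) - i + 1 / 2))) := by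
      rw [div_sub_div _ _ a2 a1, div_mul_div_comm, mul_div_assoc']
      congr 1 <;> ring
    have s2 : 1 / ((k : ℝ) + i + 3 / 2) - 1 / ((n : ℝ) + i + 3 / 2) =
        ((n : ℝ) - k) * (1 / ((n : ℝ) + i + 3 / 2) * (1 / ((k : ℝ) + i + 3 / 2))) := by
      rw [div_sub_div _ _ a4 a3, div_mul_div_comm, mul_div_assoc']
      congr 1 <;> ring
    rw [div_eq_iff hnk', add_sub_add_comm, s1, s2]
    ring
  have hlim : Filter.Tendsto (fun N => 64 * ∑ n ∈ T, y n ^ 2 +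
      ∑ n ∈ T, ∑ k ∈ T, if n = k then 0 else y n * y k * E N n k) Filter.atTop
      (nhds (64 * ∑ n ∈ T, y n ^ 2 + ∑ n ∈ T, ∑ k ∈ T, (0 : ℝ))) := by
    refine tendsto_const_nhds.add (tendsto_finsetSum _ fun n _ => tendsto_finsetSum _ fun k _ => ?_)
    by_cases h : n = k
    · simp [h]
    · simpa [h] using (hoff n k h).const_mul (y n * y k)
  simp only [Finset.sum_const_zero, add_zero] at hlim
  refine ge_of_tendsto hlim ?_
  filter_upwards [Filter.eventually_ge_atTop (S.sup id + 1)] with N hN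
  have hS : S ⊆ Finset.range N := fun m hm => by
    have := Finset.le_sup (f := id) hm
    simp only [id] at this
    exact Finset.mem_range.2 (by omega)
  calc ∑ m ∈ S, (∑ n ∈ T, 1 / ((n : ℝ) - m + 1 / 2) * y n) ^ 2
      ≤ ∑ m ∈ Finset.range N, (∑ n ∈ T, 1 / ((n : ℝ) - m + 1 / 2) * y n) ^ 2 :=
        Finset.sum_le_sum_of_subset_of_nonneg hS fun _ _ _ => sq_nonneg _
    _ ≤ ∑ m ∈ Finset.range N, ((∑ n ∈ T, 1 / ((n : ℝ) - m + 1 / 2) * y n) ^ 2 +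
          (∑ n ∈ T, 1 / ((n : ℝ) + m + 3 / 2) * y n) ^ 2) :=
        Finset.sum_le_sum fun _ _ => le_add_of_nonneg_right (sq_nonneg _)
    _ = ∑ n ∈ T, ∑ k ∈ T, y n * y k * E N n k := by
        have ex : ∀ f : ℕ → ℝ, (∑ n ∈ T, f n * y n) ^ 2 =
            ∑ n ∈ T, ∑ k ∈ T, y n * y k * (f n * f k) := fun f => by
          rw [sq, Finset.sum_mul_sum]
          exact Finset.sum_congr rfl fun _ _ => Finset.sum_congr rfl fun _ _ => by ring
        simp only [ex, hE, ← Finset.sum_add_distrib, Finset.mul_sum, ← mul_add]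
        rw [Finset.sum_comm]
        exact Finset.sum_congr rfl fun n _ => Finset.sum_comm
    _ = ∑ n ∈ T, (y n ^ 2 * E N n n + ∑ k ∈ T, if n = k then 0 else y n * y k * E N n k) := by
        refine Finset.sum_congr rfl fun n hn => ?_
        rw [← Finset.add_sum_erase _ _ hn, ← Finset.add_sum_erase _ (fun k => if n = k then _ else _) hn]
        simp only [if_true, zero_add, sq]
        congr 1
        refine Finset.sum_congr rfl fun k hk => ?_
        rw [if_neg (Finset.ne_of_mem_erase hk).symm]
    _ ≤ _ := by
        rw [Finset.sum_add_distrib, Finset.mul_sum]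
        refine add_le_add (Finset.sum_le_sum fun n _ => ?_) le_rfl
        rw [mul_comm]
        refine mul_le_mul_of_nonneg_right ?_ (sq_nonneg _)
        refine le_of_eq_of_le ?_ (hilbert_diag_le n N)
        refine Finset.sum_congr rfl fun i _ => ?_
        rw [div_mul_div_comm, div_mul_div_comm, one_mul, sq, sq]

theorem formBound_hilbert : FormBound 32 fun m n => 1 / ((n : ℝ) - m + 1 / 2) := by
  intro S T x y
  have h := hilbert_sum_sq_le S T y
  have e : ∑ m ∈ S, ∑ n ∈ T, x m * (1 / ((n : ℝ) - m + 1 / 2)) * y n =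
      ∑ m ∈ S, x m * ∑ n ∈ T, 1 / ((n : ℝ) - m + 1 / 2) * y n := by
    simp only [Finset.mul_sum, mul_assoc]
  have h0 : 0 ≤ ∑ m ∈ S, x m ^ 2 := Finset.sum_nonneg fun _ _ => sq_nonneg _
  have h1 : |∑ m ∈ S, x m * ∑ n ∈ T, 1 / ((n : ℝ) - m + 1 / 2) * y n| ≤
      ∑ m ∈ S, (x m ^ 2 / 2 + (∑ n ∈ T, 1 / ((n : ℝ) - m + 1 / 2) * y n) ^ 2 / 2) := by
    refine (Finset.abs_sum_le_sum_abs _ _).trans (Finset.sum_le_sum fun m _ => ?_)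
    generalize ∑ n ∈ T, 1 / ((n : ℝ) - m + 1 / 2) * y n = z
    rw [abs_le]
    constructor <;> nlinarith [sq_nonneg (x m - z), sq_nonneg (x m + z)]
  rw [Finset.sum_add_distrib, ← Finset.sum_div, ← Finset.sum_div] at h1
  rw [e]
  linarith

/-! ### The Hilbert matrix with power weights -/

/-- The quartic root `(1 + n)^(1/4)`: a polynomial parametrization of the weights of `H²_{3/4}`. -/
noncomputable def quarticRoot (n : ℕ) : ℝ := (1 + (n : ℝ)) ^ (1 / 4 : ℝ)

theorem quarticRoot_pos (n : ℕ) : 0 < quarticRoot n := by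
  unfold quarticRoot
  positivity

theorem quarticRoot_pow_four (n : ℕ) : quarticRoot n ^ 4 = 1 + (n : ℝ) := by
  unfold quarticRoot
  rw [← Real.rpow_natCast, ← Real.rpow_mul (by positivity)]
  norm_num

theorem quarticRoot_pow_three (n : ℕ) : quarticRoot n ^ 3 = (1 + (n : ℝ)) ^ (3 / 4 : ℝ) := by
  unfold quarticRoot
  rw [← Real.rpow_natCast, ← Real.rpow_mul (by positivity)]
  norm_num

theorem quarticRoot_mono {m n : ℕ} (h : m ≤ n) : quarticRoot m ≤ quarticRoot n := by
  unfold quarticRoot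
  gcongr

theorem quarticRoot_zero : quarticRoot 0 = 1 := by simp [quarticRoot]

theorem quarticRoot_succ_sub (n : ℕ) : quarticRoot (n + 1) ^ 4 - quarticRoot n ^ 4 = 1 := by
  rw [quarticRoot_pow_four, quarticRoot_pow_four]
  push_cast
  ring

/-- A sum with terms dominated by the increments of `Φ` is at most `Φ` at its last index. -/
theorem sum_head_le {F Φ : ℕ → ℝ} (hF : ∀ n, 0 ≤ F n) (h0 : F 0 ≤ Φ 0)
    (hs : ∀ n, F (n + 1) ≤ Φ (n + 1) - Φ n) (T : Finset ℕ) (m : ℕ) :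
    ∑ n ∈ T with n ≤ m, F n ≤ Φ m := by
  have h1 : ∑ n ∈ T with n ≤ m, F n ≤ ∑ n ∈ Finset.range (m + 1), F n := by
    refine Finset.sum_le_sum_of_subset_of_nonneg (fun n hn => ?_) fun _ _ _ => hF _
    have := (Finset.mem_filter.1 hn).2
    exact Finset.mem_range.2 (by omega)
  refine h1.trans ?_
  clear h1
  induction m with
  | zero => simpa using h0
  | succ m ih =>
    rw [Finset.sum_range_succ]
    linarith [hs m]

/-- A tail with terms dominated by the decrements of `Ψ ≥ 0` is at most `Ψ` at its start. -/
theorem sum_tail_le {F Ψ : ℕ → ℝ} (hF : ∀ n, 0 ≤ F n) (hΨ : ∀ n, 0 ≤ Ψ n)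
    (hs : ∀ n, F (n + 1) ≤ Ψ n - Ψ (n + 1)) (T : Finset ℕ) (m : ℕ) :
    ∑ n ∈ T with ¬n ≤ m, F n ≤ Ψ m := by
  have h2 : ∀ N, ∑ i ∈ Finset.range N, F (m + 1 + i) ≤ Ψ m - Ψ (m + N) := by
    intro N
    induction N with
    | zero => simp
    | succ N ih =>
      rw [Finset.sum_range_succ]
      have := hs (m + N)
      rw [show m + 1 + N = m + N + 1 by ring, show m + (N + 1) = m + N + 1 by ring]
      linarith
  have h1 : ∑ n ∈ T with ¬n ≤ m, F n ≤ ∑ n ∈ Finset.Ico (m + 1) (m + 1 + (T.sup id + 1)), F n := by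
    refine Finset.sum_le_sum_of_subset_of_nonneg (fun n hn => ?_) fun _ _ _ => hF _
    have h3 := (Finset.mem_filter.1 hn).2
    have h4 := Finset.le_sup (f := id) (Finset.mem_filter.1 hn).1
    simp only [id] at h4
    exact Finset.mem_Ico.2 (by omega)
  rw [Finset.sum_Ico_eq_sum_range, Nat.add_sub_cancel_left] at h1
  linarith [h2 (T.sup id + 1), hΨ (m + (T.sup id + 1))]

theorem sum_head_inv_pow_three_le (T : Finset ℕ) (m : ℕ) :
    ∑ n ∈ T with n ≤ m, 1 / quarticRoot n ^ 3 ≤ 4 * quarticRoot m := by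
  refine sum_head_le (Φ := fun m => 4 * quarticRoot m)
    (fun n => (div_pos one_pos (pow_pos (quarticRoot_pos n) 3)).le) ?_ (fun n => ?_) T m
  · simp [quarticRoot_zero]
  · have hp := quarticRoot_pos n
    have hq := quarticRoot_pos (n + 1)
    have hpq := quarticRoot_mono (Nat.le_succ n)
    have h1 := quarticRoot_succ_sub n
    simp only [Nat.succ_eq_add_one] at hpq
    set p := quarticRoot n
    set r := quarticRoot (n + 1)
    rw [div_le_iff₀ (by positivity)]
    have e : r ^ 4 - p ^ 4 = (r - p) * (r ^ 3 + r ^ 2 * p + r * p ^ 2 + p ^ 3) := by ring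
    have f : r ^ 3 + r ^ 2 * p + r * p ^ 2 + p ^ 3 ≤ 4 * r ^ 3 := by
      have := pow_le_pow_left₀ hp.le hpq 3
      nlinarith [mul_le_mul_of_nonneg_left hpq (sq_nonneg r),
        mul_le_mul_of_nonneg_left (pow_le_pow_left₀ hp.le hpq 2) hq.le]
    nlinarith [mul_le_mul_of_nonneg_left f (sub_nonneg.2 hpq)]

theorem sum_head_inv_pow_two_le (T : Finset ℕ) (m : ℕ) :
    ∑ n ∈ T with n ≤ m, 1 / quarticRoot n ^ 2 ≤ 2 * quarticRoot m ^ 2 := by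
  refine sum_head_le (Φ := fun m => 2 * quarticRoot m ^ 2)
    (fun n => (div_pos one_pos (pow_pos (quarticRoot_pos n) 2)).le) ?_ (fun n => ?_) T m
  · simp [quarticRoot_zero]
  · have hp := quarticRoot_pos n
    have hq := quarticRoot_pos (n + 1)
    have hpq := quarticRoot_mono (Nat.le_succ n)
    have h1 := quarticRoot_succ_sub n
    simp only [Nat.succ_eq_add_one] at hpq
    set p := quarticRoot n
    set r := quarticRoot (n + 1)
    rw [div_le_iff₀ (by positivity)]
    have f := pow_le_pow_left₀ hp.le hpq 2
    nlinarith [mul_nonneg (sub_nonneg.2 f) (sub_nonneg.2 f)]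

theorem sum_tail_inv_pow_five_le (T : Finset ℕ) (m : ℕ) :
    ∑ n ∈ T with ¬n ≤ m, 1 / quarticRoot n ^ 5 ≤ 4 / quarticRoot m := by
  refine sum_tail_le (Ψ := fun m => 4 / quarticRoot m)
    (fun n => (div_pos one_pos (pow_pos (quarticRoot_pos n) 5)).le)
    (fun n => (div_pos four_pos (quarticRoot_pos n)).le) (fun n => ?_) T m
  have hp := quarticRoot_pos n
  have hq := quarticRoot_pos (n + 1)
  have hpq := quarticRoot_mono (Nat.le_succ n)
  have h1 := quarticRoot_succ_sub n
  simp only [Nat.succ_eq_add_one] at hpq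
  set p := quarticRoot n
  set r := quarticRoot (n + 1)
  have e : r ^ 4 - p ^ 4 = (r - p) * (r ^ 3 + r ^ 2 * p + r * p ^ 2 + p ^ 3) := by ring
  have f : r ^ 3 + r ^ 2 * p + r * p ^ 2 + p ^ 3 ≤ 4 * r ^ 3 := by
    have := pow_le_pow_left₀ hp.le hpq 3
    nlinarith [mul_le_mul_of_nonneg_left hpq (sq_nonneg r),
      mul_le_mul_of_nonneg_left (pow_le_pow_left₀ hp.le hpq 2) hq.le]
  have g : 1 ≤ (r - p) * (4 * r ^ 3) := by
    nlinarith [mul_le_mul_of_nonneg_left f (sub_nonneg.2 hpq)]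
  rw [div_sub_div _ _ hp.ne' hq.ne', div_le_div_iff₀ (by positivity) (by positivity)]
  have h2 : p * r ≤ r ^ 2 := by nlinarith
  nlinarith [mul_le_mul_of_nonneg_left g (sq_nonneg r)]

theorem sum_tail_inv_pow_six_le (T : Finset ℕ) (m : ℕ) :
    ∑ n ∈ T with ¬n ≤ m, 1 / quarticRoot n ^ 6 ≤ 2 / quarticRoot m ^ 2 := by
  refine sum_tail_le (Ψ := fun m => 2 / quarticRoot m ^ 2)
    (fun n => (div_pos one_pos (pow_pos (quarticRoot_pos n) 6)).le)
    (fun n => (div_pos two_pos (pow_pos (quarticRoot_pos n) 2)).le) (fun n => ?_) T m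
  have hp := quarticRoot_pos n
  have hq := quarticRoot_pos (n + 1)
  have hpq := quarticRoot_mono (Nat.le_succ n)
  have h1 := quarticRoot_succ_sub n
  simp only [Nat.succ_eq_add_one] at hpq
  have hpq2 := pow_le_pow_left₀ hp.le hpq 2
  have hp2 : 0 < quarticRoot n ^ 2 := by positivity
  have hq2 : 0 < quarticRoot (n + 1) ^ 2 := by positivity
  rw [show quarticRoot (n + 1) ^ 6 = (quarticRoot (n + 1) ^ 2) ^ 3 by ring]
  rw [show quarticRoot (n + 1) ^ 4 = (quarticRoot (n + 1) ^ 2) ^ 2 by ring,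
    show quarticRoot n ^ 4 = (quarticRoot n ^ 2) ^ 2 by ring] at h1
  generalize quarticRoot n ^ 2 = p at *
  generalize quarticRoot (n + 1) ^ 2 = r at *
  have g : 1 ≤ (r - p) * (2 * r) := by nlinarith
  rw [div_sub_div _ _ hp2.ne' hq2.ne', div_le_div_iff₀ (by positivity) (by positivity)]
  have h2 : p * r ≤ r ^ 2 := by nlinarith
  nlinarith [mul_le_mul_of_nonneg_left g (sq_nonneg r)]

/-- Mean value estimate: the commutator of the Hilbert matrix with the weight `(1 + n)^(1/4)` has
a kernel that is homogeneous of degree `-1` without singularity on the diagonal. -/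
theorem abs_commutator_le (m n : ℕ) :
    |(quarticRoot m / quarticRoot n - 1) / ((n : ℝ) - m + 1 / 2)| ≤
      2 / (quarticRoot n * max (quarticRoot m) (quarticRoot n) ^ 3) := by
  have hp := quarticRoot_pos m
  have hr := quarticRoot_pos n
  rcases eq_or_ne m n with rfl | hmn
  · rw [div_self hp.ne', sub_self, zero_div, abs_zero]
    positivity
  have hd : |(n : ℝ) - m| ≤ 2 * |(n : ℝ) - m + 1 / 2| := by
    rcases lt_or_gt_of_ne hmn with h | h
    · have : (m : ℝ) + 1 ≤ n := by exact_mod_cast h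
      rw [abs_of_nonneg (by linarith), abs_of_nonneg (by linarith)]
      linarith
    · have : (n : ℝ) + 1 ≤ m := by exact_mod_cast h
      rw [abs_of_nonpos (by linarith), abs_of_nonpos (by linarith)]
      linarith
  have hne := half_integer_ne_zero n m
  have e : (n : ℝ) - m = quarticRoot n ^ 4 - quarticRoot m ^ 4 := by
    rw [quarticRoot_pow_four, quarticRoot_pow_four]
    ring
  rw [abs_div, div_sub_one hr.ne', abs_div, abs_of_pos hr, div_div,
    div_le_div_iff₀ (by positivity) (by positivity)]
  set p := quarticRoot m
  set r := quarticRoot n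
  have h3 : |p - r| * max p r ^ 3 ≤ |(n : ℝ) - m| := by
    rw [e]
    have e2 : r ^ 4 - p ^ 4 = (r - p) * (r ^ 3 + r ^ 2 * p + r * p ^ 2 + p ^ 3) := by ring
    rw [e2, abs_mul, abs_sub_comm p r]
    gcongr
    refine le_trans ?_ (le_abs_self _)
    rcases max_choice p r with h | h <;> rw [h] <;> nlinarith [mul_pos hp hr, mul_pos (mul_pos hp hr) hr,
      mul_pos (mul_pos hp hr) hp, pow_pos hp 3, pow_pos hr 3]
  nlinarith [mul_le_mul_of_nonneg_left (h3.trans hd) hr.le]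

/-- The Hilbert matrix `1 / (n - m + 1/2)` conjugated by the weight `(1 + n)^(1/4)` is bounded
on `ℓ²`. -/
theorem formBound_weighted_hilbert :
    FormBound 44 fun m n => quarticRoot m / quarticRoot n * (1 / ((n : ℝ) - m + 1 / 2)) := by
  have hS : FormBound 12 fun m n =>
      (quarticRoot m / quarticRoot n - 1) / ((n : ℝ) - m + 1 / 2) := by
    -- The Schur weight is `(1 + n)^(-1/2)`.
    refine FormBound.of_schur (w := fun n => 1 / quarticRoot n ^ 2)
      (fun n => div_pos one_pos (pow_pos (quarticRoot_pos n) 2)) abs_commutator_le ?_ ?_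
    · intro T m
      have hm := quarticRoot_pos m
      rw [← Finset.sum_filter_add_sum_filter_not T (fun n => n ≤ m)]
      have h1 : ∑ n ∈ T with n ≤ m, 2 / (quarticRoot n * max (quarticRoot m) (quarticRoot n) ^ 3) *
          (1 / quarticRoot n ^ 2) = 2 / quarticRoot m ^ 3 *
            ∑ n ∈ T with n ≤ m, 1 / quarticRoot n ^ 3 := by
        rw [Finset.mul_sum]
        refine Finset.sum_congr rfl fun n hn => ?_
        have hn' := quarticRoot_pos n
        rw [max_eq_left (quarticRoot_mono (Finset.mem_filter.1 hn).2)]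
        field_simp
      have h2 : ∑ n ∈ T with ¬n ≤ m, 2 / (quarticRoot n * max (quarticRoot m) (quarticRoot n) ^ 3) *
          (1 / quarticRoot n ^ 2) = 2 * ∑ n ∈ T with ¬n ≤ m, 1 / quarticRoot n ^ 6 := by
        rw [Finset.mul_sum]
        refine Finset.sum_congr rfl fun n hn => ?_
        have hn' := quarticRoot_pos n
        rw [max_eq_right (quarticRoot_mono (not_le.1 (Finset.mem_filter.1 hn).2).le)]
        field_simp
      rw [h1, h2]
      have h3 := mul_le_mul_of_nonneg_left (sum_head_inv_pow_three_le T m)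
        (show 0 ≤ 2 / quarticRoot m ^ 3 by positivity)
      have h4 := sum_tail_inv_pow_six_le T m
      have e1 : 2 / quarticRoot m ^ 3 * (4 * quarticRoot m) = 8 * (1 / quarticRoot m ^ 2) := by
        field_simp
        norm_num
      have e2 : 2 / quarticRoot m ^ 2 = 2 * (1 / quarticRoot m ^ 2) := by ring
      linarith
    · intro S n
      have hn' := quarticRoot_pos n
      rw [← Finset.sum_filter_add_sum_filter_not S (fun m => m ≤ n)]
      have h1 : ∑ m ∈ S with m ≤ n, 2 / (quarticRoot n * max (quarticRoot m) (quarticRoot n) ^ 3) *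
          (1 / quarticRoot m ^ 2) = 2 / quarticRoot n ^ 4 *
            ∑ m ∈ S with m ≤ n, 1 / quarticRoot m ^ 2 := by
        rw [Finset.mul_sum]
        refine Finset.sum_congr rfl fun m hm => ?_
        have hm' := quarticRoot_pos m
        rw [max_eq_right (quarticRoot_mono (Finset.mem_filter.1 hm).2)]
        field_simp
      have h2 : ∑ m ∈ S with ¬m ≤ n, 2 / (quarticRoot n * max (quarticRoot m) (quarticRoot n) ^ 3) *
          (1 / quarticRoot m ^ 2) = 2 / quarticRoot n *
            ∑ m ∈ S with ¬m ≤ n, 1 / quarticRoot m ^ 5 := by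
        rw [Finset.mul_sum]
        refine Finset.sum_congr rfl fun m hm => ?_
        have hm' := quarticRoot_pos m
        rw [max_eq_left (quarticRoot_mono (not_le.1 (Finset.mem_filter.1 hm).2).le)]
        field_simp
      rw [h1, h2]
      have h3 := mul_le_mul_of_nonneg_left (sum_head_inv_pow_two_le S n)
        (show 0 ≤ 2 / quarticRoot n ^ 4 by positivity)
      have h4 := mul_le_mul_of_nonneg_left (sum_tail_inv_pow_five_le S n)
        (show 0 ≤ 2 / quarticRoot n by positivity)
      have e1 : 2 / quarticRoot n ^ 4 * (2 * quarticRoot n ^ 2) =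
          4 * (1 / quarticRoot n ^ 2) := by
        field_simp
        norm_num
      have e2 : 2 / quarticRoot n * (4 / quarticRoot n) = 8 * (1 / quarticRoot n ^ 2) := by
        field_simp
        norm_num
      linarith
  have h := formBound_hilbert.add hS
  norm_num only at h
  convert h using 3 with m n
  ring

/-! ### Operators on `H²_{3/4}` given by matrices -/

namespace HardySobolev

/-- `M`, acting on Taylor coefficients, is bounded for the norm of `H²_{3/4}`: the matrix
conjugated by the weight `(1 + n)^(3/4)` is bounded on `ℓ²`. -/
def IsBoundedMatrix (M : ℕ → ℕ → ℝ) : Prop :=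
  ∃ C : ℝ, 0 < C ∧ FormBound C fun m n => quarticRoot m ^ 3 * M m n / quarticRoot n ^ 3

theorem weight_eq (n : ℕ) (x : ℝ) :
    (1 + (n : ℝ)) ^ (2 * (3 / 4 : ℝ)) * |x| ^ 2 = (quarticRoot n ^ 3 * x) ^ 2 := by
  rw [weight_sq, quarticRoot_pow_three]

theorem summable_sq (f : HardySobolev (3 / 4)) :
    Summable fun n => (quarticRoot n ^ 3 * f.coeff n) ^ 2 := by
  have := f.summable_weight
  simpa only [weight_eq] using this

theorem norm_sq_eq (f : HardySobolev (3 / 4)) :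
    ‖f‖ ^ 2 = ∑' n, (quarticRoot n ^ 3 * f.coeff n) ^ 2 := by
  rw [norm_sq]
  simp only [weight_eq]

theorem sum_sq_le_norm (f : HardySobolev (3 / 4)) (T : Finset ℕ) :
    ∑ n ∈ T, (quarticRoot n ^ 3 * f.coeff n) ^ 2 ≤ ‖f‖ ^ 2 := by
  rw [norm_sq_eq]
  exact f.summable_sq.sum_le_tsum T fun _ _ => sq_nonneg _

namespace IsBoundedMatrix

/-- Finite sections of `M` are bounded on `H²_{3/4}`. The multipliers `ε` allow for changes of sign
of the coefficients of `f`. -/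
theorem sum_sq_le {M : ℕ → ℕ → ℝ} {C : ℝ} (hC : 0 < C)
    (h : FormBound C fun m n => quarticRoot m ^ 3 * M m n / quarticRoot n ^ 3)
    (f : HardySobolev (3 / 4)) (ε : ℕ → ℝ) (hε : ∀ n, ε n ^ 2 ≤ 1) (S T : Finset ℕ) :
    ∑ m ∈ S, (quarticRoot m ^ 3 * ∑ n ∈ T, M m n * (ε n * f.coeff n)) ^ 2 ≤
      4 * C ^ 2 * ‖f‖ ^ 2 := by
  have h1 := h.sum_sq_le hC S T fun n => quarticRoot n ^ 3 * (ε n * f.coeff n)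
  have e : ∀ m, ∑ n ∈ T, quarticRoot m ^ 3 * M m n / quarticRoot n ^ 3 *
      (quarticRoot n ^ 3 * (ε n * f.coeff n)) =
        quarticRoot m ^ 3 * ∑ n ∈ T, M m n * (ε n * f.coeff n) := fun m => by
    rw [Finset.mul_sum]
    refine Finset.sum_congr rfl fun n _ => ?_
    have := quarticRoot_pos n
    field_simp
  simp only [e] at h1
  refine h1.trans ?_
  gcongr
  refine le_trans (Finset.sum_le_sum fun n _ => ?_) (f.sum_sq_le_norm T)
  have : (quarticRoot n ^ 3 * (ε n * f.coeff n)) ^ 2 =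
      ε n ^ 2 * (quarticRoot n ^ 3 * f.coeff n) ^ 2 := by ring
  rw [this]
  exact mul_le_of_le_one_left (sq_nonneg _) (hε n)

/-- Each row of a bounded matrix pairs absolutely with the coefficients of `f`: choosing the signs
of the terms turns the bound for finite sums into one for sums of absolute values. -/
theorem summable {M : ℕ → ℕ → ℝ} (h : IsBoundedMatrix M) (f : HardySobolev (3 / 4)) (m : ℕ) :
    Summable fun n => M m n * f.coeff n := by
  obtain ⟨C, hC, h⟩ := h
  have hm := quarticRoot_pos m
  refine Summable.of_norm (summable_of_sum_le (c := 2 * C * ‖f‖ / quarticRoot m ^ 3)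
    (fun n => norm_nonneg _) fun T => ?_)
  have h1 := sum_sq_le hC h f (fun n => if 0 ≤ M m n * f.coeff n then 1 else -1)
    (fun n => by split_ifs <;> norm_num) {m} T
  rw [Finset.sum_singleton] at h1
  have e : ∑ n ∈ T, M m n * ((if 0 ≤ M m n * f.coeff n then 1 else -1) * f.coeff n) =
      ∑ n ∈ T, ‖M m n * f.coeff n‖ := by
    refine Finset.sum_congr rfl fun n _ => ?_
    rw [Real.norm_eq_abs]
    split_ifs with h0
    · rw [abs_of_nonneg h0, one_mul]
    · rw [abs_of_neg (not_le.1 h0)]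
      ring
  rw [e, show 4 * C ^ 2 * ‖f‖ ^ 2 = (2 * C * ‖f‖) ^ 2 by ring] at h1
  rw [le_div_iff₀ (by positivity), mul_comm]
  exact le_of_sq_le_sq h1 (by positivity)

theorem sum_tsum_sq_le {M : ℕ → ℕ → ℝ} (h : IsBoundedMatrix M) :
    ∃ C : ℝ, 0 < C ∧ ∀ (f : HardySobolev (3 / 4)) (S : Finset ℕ),
      ∑ m ∈ S, (quarticRoot m ^ 3 * ∑' n, M m n * f.coeff n) ^ 2 ≤ (C * ‖f‖) ^ 2 := by
  have hs := h.summable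
  obtain ⟨C, hC, h⟩ := h
  refine ⟨2 * C, by positivity, fun f S => ?_⟩
  have hlim : Filter.Tendsto
      (fun T : Finset ℕ => ∑ m ∈ S, (quarticRoot m ^ 3 * ∑ n ∈ T, M m n * f.coeff n) ^ 2)
      Filter.atTop (nhds (∑ m ∈ S, (quarticRoot m ^ 3 * ∑' n, M m n * f.coeff n) ^ 2)) :=
    tendsto_finsetSum _ fun m _ => ((hs f m).hasSum.const_mul _).pow 2
  refine le_of_tendsto' hlim fun T => ?_
  have := sum_sq_le hC h f (fun _ => 1) (fun _ => by norm_num) S T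
  simp only [one_mul] at this
  linarith

end IsBoundedMatrix

theorem coeff_sub (f g : HardySobolev (3 / 4)) (n : ℕ) :
    (f - g).coeff n = f.coeff n - g.coeff n := rfl

/-- The element of `H²_{3/4}` with given Taylor coefficients. -/
def ofCoeff (c : ℕ → ℝ) (h : Summable fun n => (quarticRoot n ^ 3 * c n) ^ 2) :
    HardySobolev (3 / 4) :=
  ⟨c, by
    change Summable _
    simpa only [weight_eq] using h⟩

theorem coeff_ofCoeff (c : ℕ → ℝ) (h : Summable fun n => (quarticRoot n ^ 3 * c n) ^ 2) (n : ℕ) :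
    (ofCoeff c h).coeff n = c n := rfl

/-- A bounded matrix induces a bounded operator on `H²_{3/4}`. -/
theorem IsBoundedMatrix.exists_clm {M : ℕ → ℕ → ℝ} (h : IsBoundedMatrix M) :
    ∃ L : HardySobolev (3 / 4) →L[ℝ] HardySobolev (3 / 4),
      ∀ f m, (L f).coeff m = ∑' n, M m n * f.coeff n := by
  obtain ⟨C, hC, hb⟩ := h.sum_tsum_sq_le
  have hsum : ∀ f : HardySobolev (3 / 4),
      Summable fun m => (quarticRoot m ^ 3 * ∑' n, M m n * f.coeff n) ^ 2 := fun f =>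
    summable_of_sum_le (fun _ => sq_nonneg _) (hb f)
  refine ⟨LinearMap.mkContinuous
    { toFun := fun f => ofCoeff (fun m => ∑' n, M m n * f.coeff n) (hsum f)
      map_add' := fun f g => ext_coeff fun m => ?_
      map_smul' := fun k f => ext_coeff fun m => ?_ } C fun f => ?_, fun f m => rfl⟩
  · rw [coeff_add]
    simp only [coeff_ofCoeff, coeff_add, mul_add]
    exact (h.summable f m).tsum_add (h.summable g m)
  · rw [RingHom.id_apply, coeff_smul]
    simp only [coeff_ofCoeff, coeff_smul, ← tsum_mul_left]
    exact tsum_congr fun n => by ring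
  · refine le_of_sq_le_sq ?_ (by positivity)
    rw [norm_sq_eq]
    exact (hsum f).tsum_le_of_sum_le (hb f)

/-- The operator on `H²_{3/4}` induced by a bounded matrix. -/
noncomputable def matrixOp (M : ℕ → ℕ → ℝ) (h : IsBoundedMatrix M) :
    HardySobolev (3 / 4) →L[ℝ] HardySobolev (3 / 4) :=
  h.exists_clm.choose

theorem coeff_matrixOp {M : ℕ → ℕ → ℝ} (h : IsBoundedMatrix M) (f : HardySobolev (3 / 4)) (m : ℕ) :
    (matrixOp M h f).coeff m = ∑' n, M m n * f.coeff n :=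
  h.exists_clm.choose_spec f m

/-- The monomial `zⁿ`. -/
def monomial (n : ℕ) : HardySobolev (3 / 4) :=
  ofCoeff (Pi.single n 1) (summable_of_ne_finset_zero (s := {n}) fun k hk => by
    rw [Pi.single_eq_of_ne (by simpa using hk)]
    simp)

theorem coeff_monomial (n k : ℕ) : (monomial n).coeff k = if k = n then 1 else 0 := by
  rw [monomial, coeff_ofCoeff, Pi.single_apply]

theorem coeff_matrixOp_monomial {M : ℕ → ℕ → ℝ} (h : IsBoundedMatrix M) (m n : ℕ) :
    (matrixOp M h (monomial n)).coeff m = M m n := by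
  rw [coeff_matrixOp, tsum_eq_single n fun k hk => by rw [coeff_monomial, if_neg hk, mul_zero],
    coeff_monomial, if_pos rfl, mul_one]

theorem coeff_sum {ι : Type*} (s : Finset ι) (f : ι → HardySobolev (3 / 4)) (n : ℕ) :
    (∑ i ∈ s, f i).coeff n = ∑ i ∈ s, (f i).coeff n := by
  classical
  induction s using Finset.induction_on with
  | empty => simp
  | insert a s ha ih => rw [Finset.sum_insert ha, Finset.sum_insert ha, coeff_add, ih]

/-- The Taylor polynomials of `f` converge to `f` in norm. -/
theorem tendsto_taylor (f : HardySobolev (3 / 4)) :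
    Filter.Tendsto (fun N => ∑ n ∈ Finset.range N, f.coeff n • monomial n) Filter.atTop
      (nhds f) := by
  rw [tendsto_iff_norm_sub_tendsto_zero]
  have hc : ∀ N k, (∑ n ∈ Finset.range N, f.coeff n • monomial n - f).coeff k =
      if k < N then 0 else -f.coeff k := by
    intro N k
    simp only [coeff_sub, coeff_sum, coeff_smul, coeff_monomial, mul_ite, mul_one, mul_zero,
      Finset.sum_ite_eq, Finset.mem_range]
    split_ifs <;> ring
  have hn : ∀ N, ‖∑ n ∈ Finset.range N, f.coeff n • monomial n - f‖ ^ 2 =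
      ∑' k, (quarticRoot (k + N) ^ 3 * f.coeff (k + N)) ^ 2 := by
    intro N
    rw [norm_sq_eq, ← (summable_sq _).sum_add_tsum_nat_add N,
      Finset.sum_eq_zero fun k hk => by rw [hc, if_pos (Finset.mem_range.1 hk)]; ring, zero_add]
    exact tsum_congr fun k => by rw [hc, if_neg (by omega)]; ring
  have h0 := tendsto_sum_nat_add fun k => (quarticRoot k ^ 3 * f.coeff k) ^ 2
  have := (h0.congr fun N => (hn N).symm).sqrt
  simpa only [Real.sqrt_sq (norm_nonneg _), Real.sqrt_zero] using this

/-- Bounded operators on `H²_{3/4}` are determined by their matrices. -/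
theorem clm_ext {L K : HardySobolev (3 / 4) →L[ℝ] HardySobolev (3 / 4)}
    (h : ∀ n m, (L (monomial n)).coeff m = (K (monomial n)).coeff m) : L = K := by
  ext1 f
  have hL := (L.continuous.tendsto f).comp f.tendsto_taylor
  have hK := (K.continuous.tendsto f).comp f.tendsto_taylor
  refine tendsto_nhds_unique hL (hK.congr fun N => ?_)
  simp only [Function.comp_apply, map_sum, map_smul]
  exact Finset.sum_congr rfl fun n _ => by rw [ext_coeff (h n)]

end HardySobolev

/-! ### The binomial series of `(1 - z)^(∓1/2)` -/

theorem succ_mul_multichoose_succ (r : ℂ) (n : ℕ) :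
    ((n : ℂ) + 1) * Ring.multichoose r (n + 1) = (r + n) * Ring.multichoose r n := by
  have h0 := Ring.factorial_nsmul_multichoose_eq_ascPochhammer r n
  have h1 := Ring.factorial_nsmul_multichoose_eq_ascPochhammer r (n + 1)
  rw [Polynomial.ascPochhammer_smeval_eq_eval, nsmul_eq_mul] at h0 h1
  rw [ascPochhammer_succ_eval, ← h0, Nat.factorial_succ] at h1
  have hf : (n.factorial : ℂ) ≠ 0 := by exact_mod_cast n.factorial_ne_zero
  refine mul_left_cancel₀ hf ?_
  push_cast at h1
  linear_combination h1

/-- The Taylor coefficients `4⁻ⁿ (2n choose n)` of `1 / √(1 - z)`. -/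
noncomputable def invSqrtCoeff (n : ℕ) : ℝ := (Nat.centralBinom n : ℝ) / 4 ^ n

/-- The Taylor coefficients of `√(1 - z)`. -/
noncomputable def sqrtCoeff (n : ℕ) : ℝ := invSqrtCoeff n / (1 - 2 * n)

theorem invSqrtCoeff_zero : invSqrtCoeff 0 = 1 := by simp [invSqrtCoeff]

theorem invSqrtCoeff_pos (n : ℕ) : 0 < invSqrtCoeff n :=
  div_pos (by exact_mod_cast Nat.centralBinom_pos n) (by positivity)

theorem invSqrtCoeff_succ (n : ℕ) :
    ((n : ℝ) + 1) * invSqrtCoeff (n + 1) = ((n : ℝ) + 1 / 2) * invSqrtCoeff n := by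
  have h : ((n : ℝ) + 1) * Nat.centralBinom (n + 1) = 2 * (2 * n + 1) * Nat.centralBinom n := by
    exact_mod_cast Nat.succ_mul_centralBinom_succ n
  unfold invSqrtCoeff
  rw [← mul_div_assoc, h, pow_succ]
  field_simp
  ring

theorem one_sub_two_mul_ne_zero (n : ℕ) : (1 : ℝ) - 2 * n ≠ 0 := by
  have := half_integer_ne_zero 0 n
  intro h
  apply this
  push_cast
  linarith

theorem multichoose_half (n : ℕ) : Ring.multichoose (1 / 2 : ℂ) n = (invSqrtCoeff n : ℂ) := by
  induction n with
  | zero => simp [invSqrtCoeff_zero]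
  | succ n ih =>
    have h1 := succ_mul_multichoose_succ (1 / 2) n
    have h2 : ((n : ℂ) + 1) * invSqrtCoeff (n + 1) = ((n : ℂ) + 1 / 2) * invSqrtCoeff n := by
      have h := congrArg Complex.ofReal (invSqrtCoeff_succ n)
      push_cast at h
      exact h
    refine mul_left_cancel₀ (Nat.cast_add_one_ne_zero n) ?_
    rw [h1, h2, ih]
    ring

theorem sqrtCoeff_succ (n : ℕ) :
    ((n : ℝ) + 1) * sqrtCoeff (n + 1) = ((n : ℝ) - 1 / 2) * sqrtCoeff n := by
  have h := invSqrtCoeff_succ n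
  have h1 := one_sub_two_mul_ne_zero n
  have h2 := one_sub_two_mul_ne_zero (n + 1)
  have e1 : sqrtCoeff n * (1 - 2 * n) = invSqrtCoeff n := div_mul_cancel₀ _ h1
  have e2 : sqrtCoeff (n + 1) * (1 - 2 * (n + 1 : ℕ)) = invSqrtCoeff (n + 1) :=
    div_mul_cancel₀ _ h2
  refine mul_right_cancel₀ h2 ?_
  push_cast at e2 ⊢
  linear_combination ((n : ℝ) + 1) * e2 + h - ((n : ℝ) + 1 / 2) * e1

theorem multichoose_neg_half (n : ℕ) : Ring.multichoose (-(1 / 2) : ℂ) n = (sqrtCoeff n : ℂ) := by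
  induction n with
  | zero => simp [sqrtCoeff, invSqrtCoeff_zero]
  | succ n ih =>
    have h1 := succ_mul_multichoose_succ (-(1 / 2)) n
    have h2 : ((n : ℂ) + 1) * sqrtCoeff (n + 1) = ((n : ℂ) - 1 / 2) * sqrtCoeff n := by
      have h := congrArg Complex.ofReal (sqrtCoeff_succ n)
      push_cast at h
      exact h
    refine mul_left_cancel₀ (Nat.cast_add_one_ne_zero n) ?_
    rw [h1, h2, ih]
    ring

theorem hasSum_one_sub_cpow (r : ℂ) {z : ℂ} (hz : ‖z‖ < 1) :
    HasSum (fun n => Ring.multichoose r n * z ^ n) (1 / (1 - z) ^ r) := by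
  have h := (Complex.one_div_one_sub_cpow_hasFPowerSeriesOnBall_zero r).hasSum (y := z)
    (by rw [← ENNReal.ofReal_one, Metric.eball_ofReal]; simpa using hz)
  simpa [mul_comm, FormalMultilinearSeries.ofScalars_apply_eq, ← Ring.multichoose_eq] using h

theorem hasSum_inv_csqrt {z : ℂ} (hz : ‖z‖ < 1) :
    HasSum (fun n => (invSqrtCoeff n : ℂ) * z ^ n) (1 / csqrt (1 - z)) := by
  have h := hasSum_one_sub_cpow (1 / 2) hz
  simp only [multichoose_half] at h
  exact h

theorem hasSum_csqrt {z : ℂ} (hz : ‖z‖ < 1) :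
    HasSum (fun n => (sqrtCoeff n : ℂ) * z ^ n) (csqrt (1 - z)) := by
  have h := hasSum_one_sub_cpow (-(1 / 2)) hz
  simp only [multichoose_neg_half, Complex.cpow_neg, div_inv_eq_mul, one_mul] at h
  exact h

theorem hasSum_inv_sqrt {x : ℝ} (hx : |x| < 1) :
    HasSum (fun n => invSqrtCoeff n * x ^ n) (1 / √(1 - x)) := by
  have h := hasSum_inv_csqrt (z := (x : ℂ)) (by simpa using hx)
  have e : (1 : ℂ) / csqrt (1 - x) = ((1 / √(1 - x) : ℝ) : ℂ) := by
    rw [Real.sqrt_eq_rpow, csqrt, Complex.ofReal_div, Complex.ofReal_cpow (by linarith [abs_lt.1 hx])]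
    push_cast
    rfl
  rw [e] at h
  exact_mod_cast h

/-! ### Sums over the coefficients of `1 / √(1 - z)` -/

theorem invSqrtCoeff_mul_sq_le (n : ℕ) : invSqrtCoeff n * quarticRoot n ^ 2 ≤ 1 := by
  have hb := invSqrtCoeff_pos n
  have h : invSqrtCoeff n ^ 2 * ((n : ℝ) + 1) ≤ 1 := by
    clear hb
    induction n with
    | zero => simp [invSqrtCoeff_zero]
    | succ n ih =>
      have h1 : invSqrtCoeff (n + 1) = ((n : ℝ) + 1 / 2) / (n + 1) * invSqrtCoeff n := by
        have := invSqrtCoeff_succ n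
        field_simp at this ⊢
        linarith
      refine le_trans ?_ ih
      rw [h1, mul_pow]
      have h2 : (((n : ℝ) + 1 / 2) / (n + 1)) ^ 2 * ((n : ℝ) + 1 + 1) ≤ n + 1 := by
        rw [div_pow, div_mul_eq_mul_div, div_le_iff₀ (by positivity)]
        nlinarith [(Nat.cast_nonneg n : (0 : ℝ) ≤ n)]
      have := mul_le_mul_of_nonneg_left h2 (sq_nonneg (invSqrtCoeff n))
      push_cast
      linarith
  have hq := quarticRoot_pow_four n
  have hq0 := quarticRoot_pos n
  refine le_of_sq_le_sq ?_ zero_le_one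
  rw [mul_pow, ← pow_mul, hq, one_pow]
  linarith

theorem tendsto_invSqrtCoeff : Filter.Tendsto invSqrtCoeff Filter.atTop (nhds 0) := by
  have h1 : Filter.Tendsto (fun n : ℕ => ((1 + (n : ℝ)) ^ (1 / 2 : ℝ))⁻¹) Filter.atTop (nhds 0) :=
    ((tendsto_rpow_atTop (by norm_num)).comp
      (Filter.tendsto_atTop_add_const_left _ 1 tendsto_natCast_atTop_atTop)).inv_tendsto_atTop
  refine squeeze_zero (fun n => (invSqrtCoeff_pos n).le) (fun n => ?_) h1
  have hq := quarticRoot_pos n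
  have e : (1 + (n : ℝ)) ^ (1 / 2 : ℝ) = quarticRoot n ^ 2 := by
    unfold quarticRoot
    rw [← Real.rpow_natCast, ← Real.rpow_mul (by positivity)]
    norm_num
  rw [e, ← one_div, le_div_iff₀ (by positivity)]
  exact invSqrtCoeff_mul_sq_le n

theorem summable_invSqrtCoeff_div : Summable fun n : ℕ => invSqrtCoeff n / ((n : ℝ) + 1) := by
  refine summable_of_sum_range_le (c := 2) (fun n => div_nonneg (invSqrtCoeff_pos n).le
    (by positivity)) fun N => ?_
  have h : ∀ n : ℕ, invSqrtCoeff n / ((n : ℝ) + 1) =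
      2 * invSqrtCoeff n - 2 * invSqrtCoeff (n + 1) := fun n => by
    have := invSqrtCoeff_succ n
    field_simp
    linarith
  simp only [h]
  rw [Finset.sum_range_sub' (fun n => 2 * invSqrtCoeff n), invSqrtCoeff_zero]
  linarith [invSqrtCoeff_pos N]

theorem inv_half_integer_le (m k : ℕ) :
    |1 / ((m : ℝ) - k + 1 / 2)| ≤ (2 * k + 2) / ((m : ℝ) + 1) := by
  have hne := half_integer_ne_zero m k
  have h2 : (1 : ℝ) / 2 ≤ |(m : ℝ) - k + 1 / 2| := by
    rcases le_or_gt k m with h | h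
    · have : (k : ℝ) ≤ m := by exact_mod_cast h
      rw [abs_of_nonneg (by linarith)]
      linarith
    · have : (m : ℝ) + 1 ≤ k := by exact_mod_cast h
      rw [abs_of_nonpos (by linarith)]
      linarith
  rw [abs_div, abs_one, div_le_div_iff₀ (by positivity) (by positivity)]
  have h3 := le_abs_self ((m : ℝ) - k + 1 / 2)
  nlinarith [(Nat.cast_nonneg k : (0 : ℝ) ≤ k)]

theorem summable_invSqrtCoeff_cauchy (k : ℕ) :
    Summable fun m : ℕ => invSqrtCoeff m * (1 / ((m : ℝ) - k + 1 / 2)) := by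
  refine Summable.of_norm_bounded (summable_invSqrtCoeff_div.mul_left (2 * (k : ℝ) + 2))
    fun m => ?_
  rw [Real.norm_eq_abs, abs_mul, abs_of_pos (invSqrtCoeff_pos m)]
  have := mul_le_mul_of_nonneg_left (inv_half_integer_le m k) (invSqrtCoeff_pos m).le
  refine this.trans (le_of_eq ?_)
  ring

theorem summable_invSqrtCoeff_cauchy_mul (k l : ℕ) : Summable fun m : ℕ =>
    invSqrtCoeff m * (1 / ((m : ℝ) - k + 1 / 2) * (1 / ((m : ℝ) - l + 1 / 2))) := by
  refine Summable.of_norm_bounded ((summable_invSqrtCoeff_cauchy k).norm.mul_right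
    (2 * (l : ℝ) + 2)) fun m => ?_
  rw [← mul_assoc, norm_mul]
  refine mul_le_mul_of_nonneg_left ((inv_half_integer_le m l).trans ?_) (norm_nonneg _)
  exact div_le_self (by positivity) (by linarith [(Nat.cast_nonneg m : (0 : ℝ) ≤ m)])

theorem integral_inv_sqrt_one_sub_sq :
    MeasureTheory.IntegrableOn (fun x : ℝ => 1 / √(1 - x ^ 2)) (Set.Ioc 0 1) ∧
      ∫ x in Set.Ioc (0 : ℝ) 1, 1 / √(1 - x ^ 2) = Real.pi / 2 := by
  have hd : ∀ x ∈ Set.Ioo (0 : ℝ) 1, HasDerivAt Real.arcsin (1 / √(1 - x ^ 2)) x := fun x hx =>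
    Real.hasDerivAt_arcsin (by linarith [hx.1]) hx.2.ne
  have hi : MeasureTheory.IntegrableOn (fun x : ℝ => 1 / √(1 - x ^ 2)) (Set.Ioc 0 1) :=
    intervalIntegral.integrableOn_deriv_of_nonneg Real.continuous_arcsin.continuousOn hd
      fun x _ => by positivity
  refine ⟨hi, ?_⟩
  have h := intervalIntegral.integral_eq_sub_of_hasDerivAt_of_le zero_le_one
    Real.continuous_arcsin.continuousOn hd
    ((intervalIntegrable_iff_integrableOn_Ioc_of_le zero_le_one).2 hi)
  rw [intervalIntegral.integral_of_le zero_le_one] at h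
  rw [h, Real.arcsin_one, Real.arcsin_zero, sub_zero]

/-- The arcsine series at `1`, from termwise integration of `1 / √(1 - x²)`. -/
theorem hasSum_invSqrtCoeff_arcsin :
    HasSum (fun m : ℕ => invSqrtCoeff m * (1 / ((m : ℝ) - (0 : ℕ) + 1 / 2))) Real.pi := by
  have hint : ∀ m : ℕ, ∫ x in Set.Ioc (0 : ℝ) 1, invSqrtCoeff m * (x ^ 2) ^ m =
      invSqrtCoeff m * (1 / ((m : ℝ) - (0 : ℕ) + 1 / 2)) / 2 := fun m => by
    rw [← intervalIntegral.integral_of_le zero_le_one, intervalIntegral.integral_const_mul]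
    simp only [← pow_mul]
    have e : (m : ℝ) - (0 : ℕ) + 1 / 2 = (2 * m + 1) / 2 := by push_cast; ring
    rw [integral_pow, one_pow, zero_pow (by omega), e, one_div_div]
    push_cast
    ring
  have hnorm : ∀ m : ℕ, ∫ x in Set.Ioc (0 : ℝ) 1, ‖invSqrtCoeff m * (x ^ 2) ^ m‖ =
      invSqrtCoeff m * (1 / ((m : ℝ) - (0 : ℕ) + 1 / 2)) / 2 := fun m => by
    rw [← hint]
    refine MeasureTheory.integral_congr_ae (Filter.Eventually.of_forall fun x => ?_)
    exact Real.norm_of_nonneg (mul_nonneg (invSqrtCoeff_pos m).le (by positivity))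
  have h := MeasureTheory.hasSum_integral_of_summable_integral_norm
    (F := fun (m : ℕ) (x : ℝ) => invSqrtCoeff m * (x ^ 2) ^ m)
    (μ := MeasureTheory.volume.restrict (Set.Ioc (0 : ℝ) 1))
    (fun m => ((by fun_prop : Continuous fun x : ℝ =>
      invSqrtCoeff m * (x ^ 2) ^ m).integrableOn_Icc (a := 0) (b := 1)).mono_set
        Set.Ioc_subset_Icc_self)
    (by simp only [hnorm]; exact (summable_invSqrtCoeff_cauchy 0).div_const 2)
  have e : ∫ x in Set.Ioc (0 : ℝ) 1, ∑' m : ℕ, invSqrtCoeff m * (x ^ 2) ^ m =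
      ∫ x in Set.Ioc (0 : ℝ) 1, 1 / √(1 - x ^ 2) := by
    rw [MeasureTheory.integral_Ioc_eq_integral_Ioo, MeasureTheory.integral_Ioc_eq_integral_Ioo]
    refine MeasureTheory.setIntegral_congr_fun measurableSet_Ioo fun x hx => ?_
    refine (hasSum_inv_sqrt ?_).tsum_eq
    rw [abs_of_nonneg (sq_nonneg x)]
    exact pow_lt_one₀ hx.1.le hx.2 two_ne_zero
  rw [e, integral_inv_sqrt_one_sub_sq.2] at h
  simp only [hint] at h
  have := h.mul_left 2
  rw [mul_div_cancel₀ _ (two_ne_zero)] at this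
  exact this.congr_fun fun m => by ring

theorem tendsto_invSqrtCoeff_boundary (k : ℕ) : Filter.Tendsto
    (fun m : ℕ => (m : ℝ) * invSqrtCoeff m * (1 / ((m : ℝ) - k + 1 / 2))) Filter.atTop
      (nhds 0) := by
  refine squeeze_zero_norm (fun m => ?_)
    (by simpa using tendsto_invSqrtCoeff.const_mul (2 * (k : ℝ) + 2))
  have hb := invSqrtCoeff_pos m
  rw [norm_mul, norm_mul, Real.norm_of_nonneg hb.le, Real.norm_of_nonneg (Nat.cast_nonneg m)]
  have h1 := mul_le_mul_of_nonneg_left (inv_half_integer_le m k)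
    (mul_nonneg (Nat.cast_nonneg m : (0 : ℝ) ≤ m) hb.le)
  refine h1.trans ?_
  rw [mul_div_assoc', div_le_iff₀ (by positivity)]
  nlinarith [mul_nonneg hb.le (by positivity : (0 : ℝ) ≤ 2 * k + 2)]

/-- Contiguity relation `(x + 1/2) G(x + 1) = x G(x)` of `G(x) = ∑ b_m / (m + x) = B(x, 1/2)` at
`x = -k - 1/2`. -/
theorem invSqrtCoeff_cauchy_succ (k : ℕ) :
    ((k : ℝ) + 1 / 2) * ∑' m : ℕ, invSqrtCoeff m * (1 / ((m : ℝ) - (k + 1 : ℕ) + 1 / 2)) =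
      k * ∑' m : ℕ, invSqrtCoeff m * (1 / ((m : ℝ) - k + 1 / 2)) := by
  have h := ((summable_invSqrtCoeff_cauchy k).hasSum.mul_left (k : ℝ)).sub
    ((summable_invSqrtCoeff_cauchy (k + 1)).hasSum.mul_left ((k : ℝ) + 1 / 2))
  have h2 := h.tendsto_sum_nat
  have h3 := tendsto_nhds_unique h2
    ((tendsto_invSqrtCoeff_boundary (k + 1)).congr fun N => ?_)
  · linarith
  · have := Finset.sum_range_sub
      (fun m : ℕ => (m : ℝ) * invSqrtCoeff m * (1 / ((m : ℝ) - (k + 1 : ℕ) + 1 / 2))) N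
    simp only [Nat.cast_zero, zero_mul, sub_zero] at this
    rw [← this]
    refine Finset.sum_congr rfl fun m _ => ?_
    have a1 := half_integer_ne_zero m k
    have a2 := half_integer_ne_zero m (k + 1)
    rw [Nat.cast_add, Nat.cast_one, invSqrtCoeff_succ]
    have e : (m : ℝ) + 1 - (k + 1 : ℕ) + 1 / 2 = m - k + 1 / 2 := by push_cast; ring
    rw [e]
    have c1 : ((m : ℝ) + 1 / 2) * (1 / ((m : ℝ) - k + 1 / 2)) =
        1 + k * (1 / ((m : ℝ) - k + 1 / 2)) := by
      linear_combination mul_one_div_cancel a1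
    have c2 : (m : ℝ) * (1 / ((m : ℝ) - (k + 1 : ℕ) + 1 / 2)) =
        1 + (k + 1 / 2) * (1 / ((m : ℝ) - (k + 1 : ℕ) + 1 / 2)) := by
      have hc : ((k + 1 : ℕ) : ℝ) = k + 1 := by push_cast; rfl
      linear_combination mul_one_div_cancel a2 + 1 / ((m : ℝ) - (k + 1 : ℕ) + 1 / 2) * hc
    linear_combination invSqrtCoeff m * c1 - invSqrtCoeff m * c2

/-- The relation `(k + 1/2) W_{k+1} = k W_k` of `invSqrtCoeff_cauchy_succ` kills all `W_k` with
`k ≥ 1`, starting from the factor `k = 0`. -/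
theorem tsum_invSqrtCoeff_cauchy (k : ℕ) :
    ∑' m : ℕ, invSqrtCoeff m * (1 / ((m : ℝ) - k + 1 / 2)) = if k = 0 then Real.pi else 0 := by
  cases k with
  | zero => simpa using hasSum_invSqrtCoeff_arcsin.tsum_eq
  | succ k =>
    rw [if_neg k.succ_ne_zero]
    have hk : ∀ k : ℕ, (k : ℝ) * ∑' m : ℕ, invSqrtCoeff m * (1 / ((m : ℝ) - k + 1 / 2)) = 0 := by
      intro k
      induction k with
      | zero => simp
      | succ k ih =>
        rw [← invSqrtCoeff_cauchy_succ] at ih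
        have : (k : ℝ) + 1 / 2 ≠ 0 := by positivity
        rw [(mul_eq_zero.1 ih).resolve_left this, mul_zero]
    exact (mul_eq_zero.1 (hk (k + 1))).resolve_left (by positivity)

theorem tsum_invSqrtCoeff_cauchy_mul_of_ne {k l : ℕ} (hkl : k ≠ l) :
    ∑' m : ℕ, invSqrtCoeff m * (1 / ((m : ℝ) - k + 1 / 2) * (1 / ((m : ℝ) - l + 1 / 2))) =
      ((if k = 0 then Real.pi else 0) - (if l = 0 then Real.pi else 0)) / ((k : ℝ) - l) := by
  have hkl' : (k : ℝ) - l ≠ 0 := by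
    rw [sub_ne_zero]
    exact_mod_cast hkl
  rw [← tsum_invSqrtCoeff_cauchy k, ← tsum_invSqrtCoeff_cauchy l,
    ← (summable_invSqrtCoeff_cauchy k).tsum_sub (summable_invSqrtCoeff_cauchy l),
    ← tsum_div_const]
  refine tsum_congr fun m => ?_
  have a1 := half_integer_ne_zero m k
  have a2 := half_integer_ne_zero m l
  have : 1 / ((m : ℝ) - k + 1 / 2) - 1 / ((m : ℝ) - l + 1 / 2) =
      ((k : ℝ) - l) * (1 / ((m : ℝ) - k + 1 / 2) * (1 / ((m : ℝ) - l + 1 / 2))) := by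
    rw [div_sub_div _ _ a1 a2, div_mul_div_comm, mul_div_assoc']
    congr 1
    ring
  rw [← mul_sub, this]
  field_simp

/-- The derivative of the contiguity relation `invSqrtCoeff_cauchy_succ`. -/
theorem invSqrtCoeff_cauchy_sq_succ (k : ℕ) :
    ((k : ℝ) + 1 / 2) * ∑' m : ℕ, invSqrtCoeff m *
        (1 / ((m : ℝ) - (k + 1 : ℕ) + 1 / 2) * (1 / ((m : ℝ) - (k + 1 : ℕ) + 1 / 2))) =
      k * ∑' m : ℕ, invSqrtCoeff m * (1 / ((m : ℝ) - k + 1 / 2) * (1 / ((m : ℝ) - k + 1 / 2))) +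
        if k = 0 then Real.pi else 0 := by
  have h := (((summable_invSqrtCoeff_cauchy_mul k k).hasSum.mul_left (k : ℝ)).sub
    ((summable_invSqrtCoeff_cauchy_mul (k + 1) (k + 1)).hasSum.mul_left ((k : ℝ) + 1 / 2))).add
    ((summable_invSqrtCoeff_cauchy k).hasSum.sub (summable_invSqrtCoeff_cauchy (k + 1)).hasSum)
  rw [tsum_invSqrtCoeff_cauchy k, tsum_invSqrtCoeff_cauchy (k + 1), if_neg k.succ_ne_zero] at h
  have h2 := h.tendsto_sum_nat
  have hlim : Filter.Tendsto (fun m : ℕ => (m : ℝ) * invSqrtCoeff m *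
      (1 / ((m : ℝ) - (k + 1 : ℕ) + 1 / 2)) * (1 / ((m : ℝ) - (k + 1 : ℕ) + 1 / 2)))
      Filter.atTop (nhds 0) := by
    have hb : Filter.Tendsto (fun m : ℕ => 1 / ((m : ℝ) - (k + 1 : ℕ) + 1 / 2)) Filter.atTop
        (nhds 0) := by
      simp only [one_div, sub_eq_add_neg, add_assoc]
      exact (Filter.tendsto_atTop_add_const_right _ _
        tendsto_natCast_atTop_atTop).inv_tendsto_atTop
    simpa using (tendsto_invSqrtCoeff_boundary (k + 1)).mul hb
  have h3 := tendsto_nhds_unique h2 (hlim.congr fun N => ?_)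
  · linarith
  · have := Finset.sum_range_sub
      (fun m : ℕ => (m : ℝ) * invSqrtCoeff m * (1 / ((m : ℝ) - (k + 1 : ℕ) + 1 / 2)) *
        (1 / ((m : ℝ) - (k + 1 : ℕ) + 1 / 2))) N
    simp only [Nat.cast_zero, zero_mul, sub_zero] at this
    rw [← this]
    refine Finset.sum_congr rfl fun m _ => ?_
    have a1 := half_integer_ne_zero m k
    have a2 := half_integer_ne_zero m (k + 1)
    rw [Nat.cast_add, Nat.cast_one, invSqrtCoeff_succ]
    have e : (m : ℝ) + 1 - (k + 1 : ℕ) + 1 / 2 = m - k + 1 / 2 := by push_cast; ring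
    rw [e]
    have c1 : ((m : ℝ) + 1 / 2) * (1 / ((m : ℝ) - k + 1 / 2)) =
        1 + k * (1 / ((m : ℝ) - k + 1 / 2)) := by
      linear_combination mul_one_div_cancel a1
    have c2 : (m : ℝ) * (1 / ((m : ℝ) - (k + 1 : ℕ) + 1 / 2)) =
        1 + (k + 1 / 2) * (1 / ((m : ℝ) - (k + 1 : ℕ) + 1 / 2)) := by
      have hc : ((k + 1 : ℕ) : ℝ) = k + 1 := by push_cast; rfl
      linear_combination mul_one_div_cancel a2 + 1 / ((m : ℝ) - (k + 1 : ℕ) + 1 / 2) * hc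
    linear_combination invSqrtCoeff m * (1 / ((m : ℝ) - k + 1 / 2)) * c1 -
      invSqrtCoeff m * (1 / ((m : ℝ) - (k + 1 : ℕ) + 1 / 2)) * c2

theorem tsum_invSqrtCoeff_cauchy_sq (k : ℕ) :
    ∑' m : ℕ, invSqrtCoeff m *
        (1 / ((m : ℝ) - (k + 1 : ℕ) + 1 / 2) * (1 / ((m : ℝ) - (k + 1 : ℕ) + 1 / 2))) =
      Real.pi / (((k : ℝ) + 1 / 2) * invSqrtCoeff k) := by
  have hk : (k : ℝ) + 1 / 2 ≠ 0 := by positivity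
  have hb := (invSqrtCoeff_pos k).ne'
  induction k with
  | zero =>
    have := invSqrtCoeff_cauchy_sq_succ 0
    simp only [Nat.cast_zero, zero_mul, if_true] at this
    rw [invSqrtCoeff_zero, Nat.cast_zero, eq_div_iff (by norm_num)]
    linarith
  | succ k ih =>
    have h := invSqrtCoeff_cauchy_sq_succ (k + 1)
    have hb' := (invSqrtCoeff_pos k).ne'
    rw [ih (by positivity) hb', if_neg k.succ_ne_zero, add_zero] at h
    rw [eq_div_iff (mul_ne_zero hk hb), mul_comm _ (_ * _), mul_right_comm, h,
      ← invSqrtCoeff_succ]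
    have := invSqrtCoeff_pos (k + 1)
    push_cast
    field_simp

/-! ### The Toeplitz operator and its inverse on Taylor coefficients -/

/-- On sequences `f` with `∑ f_n = 0`, the Toeplitz matrix `1 / (π (m - n + 1/2))` acts as
`n / (π (m + 1/2) (m - n + 1/2))`, its difference with the matrix `1 / (π (m + 1/2))`. Unlike the
Toeplitz matrix, this one is bounded on the whole of `H²_{3/4}`. -/
noncomputable def reducedToeplitz (m n : ℕ) : ℝ :=
  n / (Real.pi * ((m : ℝ) + 1 / 2)) * (1 / ((m : ℝ) - n + 1 / 2))

/-- The closed form of the matrix of `g ↦ √(1 - z) P₊[g / √(1 - conj ζ)]`. -/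
noncomputable def inverseToeplitz (m n : ℕ) : ℝ :=
  invSqrtCoeff m * (invSqrtCoeff n * ((n : ℝ) + 1 / 2)) * (1 / ((n : ℝ) - m + 1 / 2))

/-- The matrix of `f ↦ f(1)`, with values in the constant functions. -/
def evalOneMatrix (m _n : ℕ) : ℝ := if m = 0 then 1 else 0

namespace HardySobolev

theorem isBoundedMatrix_reducedToeplitz : IsBoundedMatrix reducedToeplitz := by
  have h := formBound_weighted_hilbert.transpose.diag_mul (c := 1) (by norm_num)
    (u := fun m => quarticRoot m ^ 4 / (Real.pi * ((m : ℝ) + 1 / 2)))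
    (v := fun n => n / quarticRoot n ^ 4) (fun m => ?_) (fun n => ?_)
  · refine ⟨44 * 1 ^ 2, by norm_num, ?_⟩
    convert h using 3 with m n
    have hm := quarticRoot_pos m
    have hn := quarticRoot_pos n
    have hne := half_integer_ne_zero m n
    unfold reducedToeplitz
    field_simp
  · rw [quarticRoot_pow_four, abs_of_nonneg (by positivity), div_le_one (by positivity)]
    nlinarith [Real.pi_gt_three, (Nat.cast_nonneg m : (0 : ℝ) ≤ m)]
  · rw [quarticRoot_pow_four, abs_of_nonneg (by positivity), div_le_one (by positivity)]
    linarith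

theorem isBoundedMatrix_inverseToeplitz : IsBoundedMatrix inverseToeplitz := by
  have h := formBound_weighted_hilbert.diag_mul (c := 1) (by norm_num)
    (u := fun m => invSqrtCoeff m * quarticRoot m ^ 2)
    (v := fun n => invSqrtCoeff n * ((n : ℝ) + 1 / 2) / quarticRoot n ^ 2) (fun m => ?_)
    (fun n => ?_)
  · refine ⟨44 * 1 ^ 2, by norm_num, ?_⟩
    convert h using 3 with m n
    have hm := quarticRoot_pos m
    have hn := quarticRoot_pos n
    have hne := half_integer_ne_zero n m
    unfold inverseToeplitz
    field_simp
  · rw [abs_of_nonneg (mul_nonneg (invSqrtCoeff_pos m).le (sq_nonneg _))]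
    exact invSqrtCoeff_mul_sq_le m
  · have hb := invSqrtCoeff_pos n
    have hq := quarticRoot_pos n
    rw [abs_of_nonneg (by positivity), div_le_iff₀ (by positivity), one_mul]
    have h1 := mul_le_mul_of_nonneg_right (invSqrtCoeff_mul_sq_le n) (sq_nonneg (quarticRoot n))
    have h2 : invSqrtCoeff n * quarticRoot n ^ 2 * quarticRoot n ^ 2 =
        invSqrtCoeff n * (1 + n) := by
      rw [← quarticRoot_pow_four]
      ring
    nlinarith

theorem isBoundedMatrix_evalOne : IsBoundedMatrix evalOneMatrix := by
  refine ⟨3, by norm_num, FormBound.of_schur (w := fun n => 1 / quarticRoot n ^ 3)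
    (R := fun m n => if m = 0 then 1 / quarticRoot n ^ 3 else 0)
    (fun n => div_pos one_pos (pow_pos (quarticRoot_pos n) 3)) (fun m n => ?_) (fun T m => ?_)
    fun S n => ?_⟩
  · have hn := quarticRoot_pos n
    unfold evalOneMatrix
    split_ifs with h
    · rw [h, quarticRoot_zero, one_pow, one_mul, abs_of_pos (by positivity)]
    · simp
  · by_cases hm : m = 0
    · simp only [hm, if_true, quarticRoot_zero]
      have e : ∀ n, 1 / quarticRoot n ^ 3 * (1 / quarticRoot n ^ 3) = 1 / quarticRoot n ^ 6 :=
        fun n => by rw [div_mul_div_comm, one_mul, ← pow_add]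
      simp only [e]
      rw [← Finset.sum_filter_add_sum_filter_not T (fun n => n ≤ 0)]
      have h1 := sum_tail_inv_pow_six_le T 0
      have h2 : ∑ n ∈ T with n ≤ 0, 1 / quarticRoot n ^ 6 ≤ ∑ n ∈ {0}, 1 / quarticRoot n ^ 6 := by
        refine Finset.sum_le_sum_of_subset_of_nonneg (fun n hn => ?_) fun n _ _ => ?_
        · simpa using (Finset.mem_filter.1 hn).2
        · have := quarticRoot_pos n
          positivity
      rw [Finset.sum_singleton, quarticRoot_zero] at h2
      rw [quarticRoot_zero] at h1
      norm_num at h1 h2 ⊢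
      linarith
    · have := quarticRoot_pos m
      simp only [if_neg hm, zero_mul, Finset.sum_const_zero]
      positivity
  · have hn := quarticRoot_pos n
    simp only [ite_mul, zero_mul, Finset.sum_ite_eq', quarticRoot_zero]
    split_ifs
    · have : (0 : ℝ) ≤ 1 / quarticRoot n ^ 3 := by positivity
      rw [one_pow, div_one, mul_one]
      linarith
    · positivity

/-- Evaluation at `1`, as an operator into the constant functions. -/
noncomputable def evalOneOp : HardySobolev (3 / 4) →L[ℝ] HardySobolev (3 / 4) :=
  matrixOp evalOneMatrix isBoundedMatrix_evalOne

/-- A bounded operator on `H²_{3/4}` that extends `f ↦ P₊[f / √(-ζ)]` from the functions with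
`f(1) = 0`. -/
noncomputable def reducedToeplitzOp : HardySobolev (3 / 4) →L[ℝ] HardySobolev (3 / 4) :=
  matrixOp reducedToeplitz isBoundedMatrix_reducedToeplitz

/-- The operator `g ↦ √(1 - z) P₊[g / √(1 - conj ζ)]`. -/
noncomputable def inverseToeplitzOp : HardySobolev (3 / 4) →L[ℝ] HardySobolev (3 / 4) :=
  matrixOp inverseToeplitz isBoundedMatrix_inverseToeplitz

theorem one_div_half_integer_neg (n k : ℕ) :
    1 / ((n : ℝ) - k + 1 / 2) = -(1 / ((k : ℝ) - (n + 1 : ℕ) + 1 / 2)) := by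
  rw [← one_div_neg_eq_neg_one_div]
  congr 1
  push_cast
  ring

theorem evalOneOp_comp_inverseToeplitzOp : evalOneOp.comp inverseToeplitzOp = 0 := by
  refine clm_ext fun n m => ?_
  rw [ContinuousLinearMap.comp_apply, evalOneOp, coeff_matrixOp]
  simp only [inverseToeplitzOp, coeff_matrixOp_monomial, zero_apply, coeff_zero]
  have e : ∀ k, evalOneMatrix m k * inverseToeplitz k n =
      (if m = 0 then 1 else 0) * -(invSqrtCoeff n * ((n : ℝ) + 1 / 2)) *
        (invSqrtCoeff k * (1 / ((k : ℝ) - (n + 1 : ℕ) + 1 / 2))) := fun k => by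
    rw [evalOneMatrix, inverseToeplitz, one_div_half_integer_neg]
    ring
  simp only [e]
  rw [tsum_mul_left, tsum_invSqrtCoeff_cauchy, if_neg n.succ_ne_zero, mul_zero]

theorem reducedToeplitz_eq (m n : ℕ) : reducedToeplitz m n =
    1 / Real.pi * (1 / ((m : ℝ) - n + 1 / 2)) - 1 / Real.pi * (1 / ((m : ℝ) + 1 / 2)) := by
  have h1 := half_integer_ne_zero m n
  have h2 : (m : ℝ) + 1 / 2 ≠ 0 := by positivity
  have h3 : 1 / ((m : ℝ) - n + 1 / 2) - 1 / ((m : ℝ) + 1 / 2) =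
      n / ((m : ℝ) + 1 / 2) * (1 / ((m : ℝ) - n + 1 / 2)) := by
    rw [div_sub_div _ _ h1 h2, div_mul_div_comm, mul_comm ((m : ℝ) + 1 / 2)]
    congr 1
    ring
  rw [← mul_sub, h3, reducedToeplitz, ← div_div]
  ring

theorem reducedToeplitzOp_comp_inverseToeplitzOp :
    reducedToeplitzOp.comp inverseToeplitzOp = ContinuousLinearMap.id ℝ _ := by
  refine clm_ext fun n m => ?_
  rw [ContinuousLinearMap.comp_apply, reducedToeplitzOp, coeff_matrixOp]
  simp only [inverseToeplitzOp, coeff_matrixOp_monomial, ContinuousLinearMap.id_apply,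
    coeff_monomial]
  set c := invSqrtCoeff n * ((n : ℝ) + 1 / 2) / Real.pi with hc
  have e : ∀ k, reducedToeplitz m k * inverseToeplitz k n =
      c * (invSqrtCoeff k * (1 / ((k : ℝ) - (m + 1 : ℕ) + 1 / 2) *
        (1 / ((k : ℝ) - (n + 1 : ℕ) + 1 / 2)))) + c * (1 / ((m : ℝ) + 1 / 2)) *
        (invSqrtCoeff k * (1 / ((k : ℝ) - (n + 1 : ℕ) + 1 / 2))) := fun k => by
    rw [reducedToeplitz_eq, inverseToeplitz, one_div_half_integer_neg m k,
      one_div_half_integer_neg n k, hc]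
    ring
  simp only [e]
  rw [((summable_invSqrtCoeff_cauchy_mul _ _).mul_left _).tsum_add
      ((summable_invSqrtCoeff_cauchy _).mul_left _), tsum_mul_left, tsum_mul_left,
    tsum_invSqrtCoeff_cauchy, if_neg n.succ_ne_zero, mul_zero, add_zero]
  split_ifs with hmn
  · subst hmn
    rw [tsum_invSqrtCoeff_cauchy_sq, hc]
    have := (invSqrtCoeff_pos m).ne'
    have := Real.pi_ne_zero
    field_simp
  · rw [tsum_invSqrtCoeff_cauchy_mul_of_ne (by omega), if_neg n.succ_ne_zero,
      if_neg m.succ_ne_zero, sub_zero, zero_div, mul_zero]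

theorem inverseToeplitzOp_comp_reducedToeplitzOp :
    inverseToeplitzOp.comp reducedToeplitzOp = ContinuousLinearMap.id ℝ _ - evalOneOp := by
  refine clm_ext fun n m => ?_
  rw [ContinuousLinearMap.comp_apply, inverseToeplitzOp, coeff_matrixOp, sub_apply, coeff_sub]
  simp only [reducedToeplitzOp, evalOneOp, coeff_matrixOp_monomial, ContinuousLinearMap.id_apply,
    coeff_monomial, evalOneMatrix]
  have e : ∀ k, inverseToeplitz m k * reducedToeplitz k n = invSqrtCoeff m * n / Real.pi *
      (invSqrtCoeff k * (1 / ((k : ℝ) - m + 1 / 2) * (1 / ((k : ℝ) - n + 1 / 2)))) := fun k => by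
    have hk : (k : ℝ) + 1 / 2 ≠ 0 := by positivity
    rw [reducedToeplitz, inverseToeplitz, ← div_div]
    field_simp
  simp only [e]
  rw [tsum_mul_left]
  have hpi := Real.pi_ne_zero
  rcases eq_or_ne m n with rfl | hmn
  · rcases m with _ | k
    · simp
    · rw [tsum_invSqrtCoeff_cauchy_sq, ← invSqrtCoeff_succ, if_pos rfl, if_neg k.succ_ne_zero]
      have := (invSqrtCoeff_pos (k + 1)).ne'
      push_cast
      field_simp
      norm_num
  · rw [tsum_invSqrtCoeff_cauchy_mul_of_ne hmn, if_neg hmn]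
    rcases eq_or_ne m 0 with rfl | hm
    · rw [if_pos rfl, if_pos rfl, if_neg hmn.symm, invSqrtCoeff_zero]
      have : (n : ℝ) ≠ 0 := by exact_mod_cast hmn.symm
      push_cast
      field_simp
      ring
    · rw [if_neg hm, if_neg hm]
      rcases eq_or_ne n 0 with rfl | hn
      · simp
      · simp [hn]

theorem summable_coeff (f : HardySobolev (3 / 4)) : Summable f.coeff :=
  f.summable_abs_coeff.of_abs

theorem eval_one_eq (f : HardySobolev (3 / 4)) : f 1 = ((∑' n, f.coeff n : ℝ) : ℂ) := by
  simp [eval, Complex.ofReal_tsum]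

theorem mem_zero_iff (f : HardySobolev (3 / 4)) :
    f ∈ HardySobolevZero ↔ ∑' n, f.coeff n = 0 := by
  change f 1 = 0 ↔ _
  rw [eval_one_eq, Complex.ofReal_eq_zero]

theorem evalOneOp_eq_zero_iff (f : HardySobolev (3 / 4)) :
    evalOneOp f = 0 ↔ f ∈ HardySobolevZero := by
  have h : ∀ m, (evalOneOp f).coeff m = (if m = 0 then 1 else 0) * ∑' n, f.coeff n := fun m => by
    rw [evalOneOp, coeff_matrixOp, ← tsum_mul_left]
    rfl
  rw [mem_zero_iff]
  constructor
  · intro h0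
    have := h 0
    rw [h0] at this
    simpa using this.symm
  · intro h0
    refine ext_coeff fun m => ?_
    rw [h, h0, mul_zero, coeff_zero]

theorem inverseToeplitzOp_mem (g : HardySobolev (3 / 4)) :
    inverseToeplitzOp g ∈ HardySobolevZero := by
  rw [← evalOneOp_eq_zero_iff]
  exact DFunLike.congr_fun evalOneOp_comp_inverseToeplitzOp g

theorem hasSum_coeff_reducedToeplitzOp {f : HardySobolev (3 / 4)} (hf : f ∈ HardySobolevZero)
    (m : ℕ) : HasSum (fun n => f.coeff n * (1 / (Real.pi * ((m : ℝ) - n + 1 / 2))))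
      ((reducedToeplitzOp f).coeff m) := by
  rw [mem_zero_iff] at hf
  have h1 := (isBoundedMatrix_reducedToeplitz.summable f m).hasSum
  have h2 := f.summable_coeff.hasSum.mul_left (1 / Real.pi * (1 / ((m : ℝ) + 1 / 2)))
  rw [reducedToeplitzOp, coeff_matrixOp]
  have h3 := h1.add h2
  rw [hf, mul_zero, add_zero] at h3
  refine h3.congr_fun fun n => ?_
  rw [reducedToeplitz_eq, ← one_div_mul_one_div]
  ring

/-- The isomorphism `f ↦ P₊[f / √(-ζ)]` of part (i). -/
noncomputable def toeplitzEquiv : HardySobolevZero ≃L[ℝ] HardySobolev (3 / 4) :=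
  ContinuousLinearEquiv.equivOfInverse (reducedToeplitzOp.comp HardySobolevZero.subtypeL)
    (inverseToeplitzOp.codRestrict HardySobolevZero inverseToeplitzOp_mem)
    (fun f => Subtype.ext (by
      have h := DFunLike.congr_fun inverseToeplitzOp_comp_reducedToeplitzOp
        (f : HardySobolev (3 / 4))
      rw [sub_apply, (evalOneOp_eq_zero_iff _).2 f.2, sub_zero] at h
      exact h))
    (fun g => DFunLike.congr_fun reducedToeplitzOp_comp_inverseToeplitzOp g)

theorem toeplitzEquiv_apply (f : HardySobolevZero) : toeplitzEquiv f = reducedToeplitzOp f := rfl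

theorem coe_toeplitzEquiv_symm_apply (g : HardySobolev (3 / 4)) :
    (toeplitzEquiv.symm g : HardySobolev (3 / 4)) = inverseToeplitzOp g := rfl

end HardySobolev

/-! ### Taylor series of `P₊[g Φ]` -/

/-- The moment `(2πi)⁻¹ ∮ ζ^(k-1) Φ(ζ) dζ`, written as an integral over the angle; it is the Fourier
coefficient of `Φ` of index `-k`. -/
noncomputable def circleMoment (Φ : ℂ → ℂ) (k : ℤ) : ℂ :=
  (2 * (Real.pi : ℂ))⁻¹ * ∫ θ in (0 : ℝ)..2 * Real.pi, circleMap 0 1 θ ^ k * Φ (circleMap 0 1 θ)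

theorem norm_circleMap_zero_one (θ : ℝ) : ‖circleMap 0 1 θ‖ = 1 := by simp

theorem circleMap_zero_one_ne_zero (θ : ℝ) : circleMap 0 1 θ ≠ 0 := by
  rw [← norm_pos_iff, norm_circleMap_zero_one]
  exact one_pos

/-- If `g = ∑ g_n ζⁿ` with `∑ |g_n| < ∞`, the Cauchy kernel may be expanded under the integral. -/
theorem hasSum_Pplus {Φ : ℂ → ℂ}
    (hΦ : IntervalIntegrable (fun θ => Φ (circleMap 0 1 θ)) MeasureTheory.volume 0 (2 * Real.pi))
    (g : HardySobolev (3 / 4)) {C : ℕ → ℂ}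
    (hC : ∀ j : ℕ, HasSum (fun n : ℕ => (g.coeff n : ℂ) * circleMoment Φ ((n : ℤ) - j)) (C j))
    {z : ℂ} (hz : ‖z‖ < 1) :
    HasSum (fun j => C j * z ^ j) (Pplus (fun ζ => g ζ * Φ ζ) z) := by
  set F : ℕ × ℕ → ℝ → ℂ := fun p θ =>
    (g.coeff p.2 * z ^ p.1) * (circleMap 0 1 θ ^ ((p.2 : ℤ) - p.1) * Φ (circleMap 0 1 θ)) with hF
  have hsum : Summable fun p : ℕ × ℕ => ‖z‖ ^ p.1 * |g.coeff p.2| :=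
    (summable_geometric_of_lt_one (norm_nonneg z) hz).mul_of_nonneg g.summable_abs_coeff
      (fun _ => by positivity) (fun _ => abs_nonneg _)
  have hmeas := hΦ.def'.aestronglyMeasurable
  have hcont : ∀ k : ℤ, Continuous fun θ : ℝ => circleMap 0 1 θ ^ k := fun k =>
    (continuous_circleMap 0 1).zpow₀ k fun θ => Or.inl (circleMap_zero_one_ne_zero θ)
  have key := intervalIntegral.hasSum_integral_of_dominated_convergence
    (μ := MeasureTheory.volume) (a := 0) (b := 2 * Real.pi) (F := F)
    (f := fun θ => g (circleMap 0 1 θ) * Φ (circleMap 0 1 θ) *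
      (circleMap 0 1 θ / (circleMap 0 1 θ - z)))
    (fun p θ => ‖z‖ ^ p.1 * |g.coeff p.2| * ‖Φ (circleMap 0 1 θ)‖)
    (fun p => (((hcont _).aestronglyMeasurable).mul hmeas).const_mul _)
    (fun p => Filter.Eventually.of_forall fun θ _ => by
      rw [hF, norm_mul, norm_mul, norm_mul, norm_pow, norm_zpow, norm_circleMap_zero_one, one_zpow,
        one_mul, Complex.norm_real, Real.norm_eq_abs, mul_comm |_|])
    (Filter.Eventually.of_forall fun θ _ => hsum.mul_right _)
    (by
      simp only [tsum_mul_right]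
      exact hΦ.norm.const_mul _)
    (Filter.Eventually.of_forall fun θ _ => ?_)
  · have h2 := (key.mul_left ((2 * (Real.pi : ℂ))⁻¹)).prod_fiberwise (f := fun p : ℕ × ℕ =>
      (2 * (Real.pi : ℂ))⁻¹ * ∫ θ in (0 : ℝ)..2 * Real.pi, F p θ) (g := fun j => C j * z ^ j)
      fun j => by
        refine ((hC j).mul_right (z ^ j)).congr_fun fun n => ?_
        rw [hF, intervalIntegral.integral_const_mul, circleMoment]
        ring
    -- With `dζ = iζ dθ` the Cauchy kernel becomes `ζ / (ζ - z)`, a geometric series in `z / ζ`.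
    have e : Pplus (fun ζ => g ζ * Φ ζ) z = (2 * (Real.pi : ℂ))⁻¹ *
        ∫ θ in (0 : ℝ)..2 * Real.pi, g (circleMap 0 1 θ) * Φ (circleMap 0 1 θ) *
          (circleMap 0 1 θ / (circleMap 0 1 θ - z)) := by
      rw [Pplus, circleIntegral, mul_inv, mul_assoc, ← intervalIntegral.integral_const_mul]
      congr 2
      ext θ
      rw [deriv_circleMap, smul_eq_mul]
      have := Complex.I_ne_zero
      field_simp
    rw [e]
    exact h2
  · have hζ := circleMap_zero_one_ne_zero θ
    have hn : ‖z / circleMap 0 1 θ‖ < 1 := by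
      rwa [norm_div, norm_circleMap_zero_one, div_one]
    have h1 := hasSum_geometric_of_norm_lt_one hn
    have h2 := g.hasSum_of_norm_le_one (norm_circleMap_zero_one θ).le
    have hs : Summable fun p : ℕ × ℕ => (z / circleMap 0 1 θ) ^ p.1 *
        ((g.coeff p.2 : ℂ) * circleMap 0 1 θ ^ p.2) :=
      summable_mul_of_summable_norm (f := fun j : ℕ => (z / circleMap 0 1 θ) ^ j)
        (g := fun n : ℕ => (g.coeff n : ℂ) * circleMap 0 1 θ ^ n) h1.summable.norm h2.summable.norm
    have h3 := (h1.mul h2 hs).mul_right (Φ (circleMap 0 1 θ))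
    have hne : circleMap 0 1 θ - z ≠ 0 := by
      intro h0
      rw [← sub_eq_zero.1 h0, norm_circleMap_zero_one] at hz
      exact lt_irrefl _ hz
    have e : (1 - z / circleMap 0 1 θ)⁻¹ = circleMap 0 1 θ / (circleMap 0 1 θ - z) := by
      rw [one_sub_div hζ, inv_div]
    rw [e] at h3
    have e4 : g (circleMap 0 1 θ) * Φ (circleMap 0 1 θ) *
        (circleMap 0 1 θ / (circleMap 0 1 θ - z)) =
          circleMap 0 1 θ / (circleMap 0 1 θ - z) * g (circleMap 0 1 θ) * Φ (circleMap 0 1 θ) := by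
      ring
    rw [e4]
    refine h3.congr_fun fun p => ?_
    simp only [hF]
    rw [div_pow, zpow_sub₀ hζ, zpow_natCast, zpow_natCast]
    field_simp

/-! ### Moments of `1 / √(-ζ)` -/

/-- The principal argument of `-e^{iθ}` is `θ - π` for `0 < θ ≤ 2π`. -/
theorem inv_csqrt_neg_circleMap {θ : ℝ} (h0 : 0 < θ) (h1 : θ ≤ 2 * Real.pi) :
    1 / csqrt (-circleMap 0 1 θ) = Complex.I * Complex.exp (-(Complex.I / 2) * θ) := by
  have e : -circleMap 0 1 θ = Complex.exp ((θ - Real.pi : ℝ) * Complex.I) := by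
    rw [circleMap_zero, Complex.ofReal_one, one_mul, Complex.ofReal_sub, sub_mul, Complex.exp_sub,
      Complex.exp_pi_mul_I]
    ring
  rw [csqrt, Complex.cpow_def_of_ne_zero (by rw [e]; exact Complex.exp_ne_zero _), e,
    Complex.log_exp (by simp; linarith) (by simp; linarith), one_div, ← Complex.exp_neg]
  have : Complex.I = Complex.exp (Real.pi / 2 * Complex.I) := Complex.exp_pi_div_two_mul_I.symm
  nth_rewrite 2 [this]
  rw [← Complex.exp_add]
  congr 1
  push_cast
  ring

theorem intervalIntegrable_inv_csqrt_neg :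
    IntervalIntegrable (fun θ => 1 / csqrt (-circleMap 0 1 θ)) MeasureTheory.volume 0
      (2 * Real.pi) := by
  have hc : Continuous fun θ : ℝ => Complex.I * Complex.exp (-(Complex.I / 2) * θ) := by fun_prop
  refine (hc.intervalIntegrable 0 (2 * Real.pi)).congr fun θ hθ => ?_
  rw [Set.uIoc_of_le (by positivity)] at hθ
  exact (inv_csqrt_neg_circleMap hθ.1 hθ.2).symm

theorem circleMoment_inv_csqrt_neg (k : ℤ) :
    circleMoment (fun ζ => 1 / csqrt (-ζ)) k = 1 / (Real.pi * (-k + 1 / 2)) := by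
  have hk : (k : ℂ) - 1 / 2 ≠ 0 := by
    intro h
    have h' : (2 * (k : ℂ) - 1) = 0 := by linear_combination 2 * h
    have h2 : (2 * k - 1 : ℤ) = 0 := by exact_mod_cast h'
    omega
  have hpi : (Real.pi : ℂ) ≠ 0 := by exact_mod_cast Real.pi_ne_zero
  have hI := Complex.I_ne_zero
  have e : ∫ θ in (0 : ℝ)..2 * Real.pi, circleMap 0 1 θ ^ k * (1 / csqrt (-circleMap 0 1 θ)) =
      ∫ θ in (0 : ℝ)..2 * Real.pi,
        Complex.I * Complex.exp (Complex.I * ((k : ℂ) - 1 / 2) * (θ : ℝ)) := by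
    refine intervalIntegral.integral_congr_ae (Filter.Eventually.of_forall fun θ hθ => ?_)
    rw [Set.uIoc_of_le (by positivity)] at hθ
    rw [inv_csqrt_neg_circleMap hθ.1 hθ.2, circleMap_zero, Complex.ofReal_one, one_mul,
      ← Complex.exp_int_mul, mul_left_comm, ← Complex.exp_add]
    congr 2
    ring
  have e2 : Complex.exp (Complex.I * ((k : ℂ) - 1 / 2) * (2 * Real.pi : ℝ)) = -1 := by
    have : Complex.I * ((k : ℂ) - 1 / 2) * (2 * Real.pi : ℝ) =
        k * (2 * Real.pi * Complex.I) - Real.pi * Complex.I := by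
      push_cast
      ring
    rw [this, Complex.exp_sub, Complex.exp_int_mul_two_pi_mul_I, Complex.exp_pi_mul_I]
    norm_num
  rw [circleMoment, e, intervalIntegral.integral_const_mul,
    integral_exp_mul_complex (mul_ne_zero hI hk), e2]
  have hk2 : -(k : ℂ) + 1 / 2 ≠ 0 := by
    intro h
    apply hk
    linear_combination -h
  simp only [Complex.ofReal_zero, mul_zero, Complex.exp_zero]
  rw [mul_div_assoc', inv_mul_eq_div, div_div, div_eq_div_iff
    (mul_ne_zero (mul_ne_zero hI hk) (mul_ne_zero two_ne_zero hpi)) (mul_ne_zero hpi hk2)]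
  ring

/-! ### Moments of `1 / √(1 - conj ζ)` -/

theorem norm_csqrt (w : ℂ) : ‖csqrt w‖ = √‖w‖ := by
  rw [csqrt, Real.sqrt_eq_rpow]
  have := Complex.norm_cpow_real w (1 / 2)
  push_cast at this
  exact this

theorem min_le_norm_one_sub_circleMap {θ : ℝ} (h0 : 0 ≤ θ) (h1 : θ ≤ 2 * Real.pi) :
    min θ (2 * Real.pi - θ) / 2 ≤ ‖1 - conj (circleMap 0 1 θ)‖ := by
  have e : ‖1 - conj (circleMap 0 1 θ)‖ = 2 * Real.sin (θ / 2) := by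
    rw [← Complex.norm_conj, map_sub, map_one, Complex.conj_conj, norm_sub_rev, circleMap_zero,
      Complex.ofReal_one, one_mul, mul_comm, Complex.norm_exp_I_mul_ofReal_sub_one, norm_mul,
      Real.norm_of_nonneg (Real.sin_nonneg_of_nonneg_of_le_pi (by linarith) (by linarith))]
    norm_num
  rw [e]
  have hpi := Real.pi_pos
  have h4 : 1 / 2 ≤ 2 / Real.pi := by
    rw [div_le_div_iff₀ two_pos hpi]
    linarith [Real.pi_le_four]
  rcases le_total θ Real.pi with h | h
  · have h2 := Real.mul_le_sin (x := θ / 2) (by linarith) (by linarith)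
    have h3 := mul_le_mul_of_nonneg_right h4 (show 0 ≤ θ / 2 by linarith)
    have := min_le_left θ (2 * Real.pi - θ)
    linarith
  · have h2 := Real.mul_le_sin (x := Real.pi - θ / 2) (by linarith) (by linarith)
    rw [Real.sin_pi_sub] at h2
    have h3 := mul_le_mul_of_nonneg_right h4 (show 0 ≤ Real.pi - θ / 2 by linarith)
    have := min_le_right θ (2 * Real.pi - θ)
    linarith

theorem norm_one_sub_le_two_mul {r : ℝ} (h0 : 0 ≤ r) (h1 : r ≤ 1) {w : ℂ} (hw : ‖w‖ = 1) :
    ‖1 - w‖ ≤ 2 * ‖1 - r * w‖ := by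
  have e : 1 - w = (1 - r * w) - ((1 - r : ℝ) : ℂ) * w := by
    push_cast
    ring
  have h2 : ‖((1 - r : ℝ) : ℂ) * w‖ = 1 - r := by
    rw [norm_mul, hw, mul_one, Complex.norm_real, Real.norm_of_nonneg (by linarith)]
  have h3 : 1 - r ≤ ‖1 - r * w‖ := by
    have := norm_sub_norm_le (1 : ℂ) (r * w)
    rwa [norm_one, norm_mul, hw, mul_one, Complex.norm_real, Real.norm_of_nonneg h0] at this
  have h4 := norm_sub_le (1 - r * w) (((1 - r : ℝ) : ℂ) * w)
  rw [e]
  linarith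

/-- An integrable majorant, uniform in the radius `r`. -/
theorem norm_inv_csqrt_le {r : ℝ} (hr0 : 0 ≤ r) (hr1 : r ≤ 1) {θ : ℝ}
    (hθ : θ ∈ Set.Ioo 0 (2 * Real.pi)) :
    ‖1 / csqrt (1 - r * conj (circleMap 0 1 θ))‖ ≤
      2 * (θ ^ (-(1 / 2) : ℝ) + (2 * Real.pi - θ) ^ (-(1 / 2) : ℝ)) := by
  have h1 := min_le_norm_one_sub_circleMap hθ.1.le hθ.2.le
  have h2 := norm_one_sub_le_two_mul hr0 hr1 (w := conj (circleMap 0 1 θ))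
    (by rw [Complex.norm_conj, norm_circleMap_zero_one])
  rw [norm_div, norm_one, norm_csqrt]
  have key : ∀ t : ℝ, 0 < t → t / 4 ≤ ‖1 - r * conj (circleMap 0 1 θ)‖ →
      1 / √‖1 - r * conj (circleMap 0 1 θ)‖ ≤ 2 * t ^ (-(1 / 2) : ℝ) := by
    intro t ht h
    have h3 : √t / 2 ≤ √‖1 - r * conj (circleMap 0 1 θ)‖ := by
      refine le_trans (le_of_eq ?_) (Real.sqrt_le_sqrt h)
      rw [Real.sqrt_div ht.le, show (4 : ℝ) = 2 ^ 2 by norm_num, Real.sqrt_sq two_pos.le]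
    have ht' := Real.sqrt_pos.2 ht
    refine (one_div_le_one_div_of_le (by positivity) h3).trans (le_of_eq ?_)
    rw [Real.rpow_neg ht.le, ← Real.sqrt_eq_rpow]
    field_simp
  have p1 : 0 ≤ θ ^ (-(1 / 2) : ℝ) := Real.rpow_nonneg hθ.1.le _
  have p2 : 0 ≤ (2 * Real.pi - θ) ^ (-(1 / 2) : ℝ) := Real.rpow_nonneg (by linarith [hθ.2]) _
  rcases min_choice θ (2 * Real.pi - θ) with h | h <;> rw [h] at h1
  · linarith [key θ hθ.1 (by linarith)]
  · linarith [key (2 * Real.pi - θ) (by linarith [hθ.2]) (by linarith)]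

theorem intervalIntegrable_majorant :
    IntervalIntegrable (fun θ : ℝ => 2 * (θ ^ (-(1 / 2) : ℝ) + (2 * Real.pi - θ) ^ (-(1 / 2) : ℝ)))
      MeasureTheory.volume 0 (2 * Real.pi) := by
  have h1 : IntervalIntegrable (fun θ : ℝ => θ ^ (-(1 / 2) : ℝ)) MeasureTheory.volume 0
      (2 * Real.pi) := intervalIntegral.intervalIntegrable_rpow' (by norm_num)
  have h2 := (h1.comp_sub_left (2 * Real.pi)).symm
  simp only [sub_zero, sub_self] at h2
  exact (h1.add h2).const_mul 2

theorem measurable_inv_csqrt (r : ℝ) :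
    Measurable fun θ : ℝ => 1 / csqrt (1 - r * conj (circleMap 0 1 θ)) := by
  have h1 : Measurable fun θ : ℝ => 1 - r * conj (circleMap 0 1 θ) :=
    (by fun_prop : Continuous fun θ : ℝ => 1 - r * conj (circleMap 0 1 θ)).measurable
  exact (h1.pow_const (1 / 2)).const_div 1

theorem ae_mem_Ioo : ∀ᵐ θ : ℝ, θ ∈ Set.uIoc 0 (2 * Real.pi) → θ ∈ Set.Ioo 0 (2 * Real.pi) := by
  have h : ∀ᵐ θ : ℝ, θ ≠ 2 * Real.pi := by simp [MeasureTheory.ae_iff]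
  filter_upwards [h] with θ hθ hm
  rw [Set.uIoc_of_le (by positivity)] at hm
  exact ⟨hm.1, lt_of_le_of_ne hm.2 hθ⟩

theorem intervalIntegrable_inv_csqrt_one_sub_conj :
    IntervalIntegrable (fun θ => 1 / csqrt (1 - conj (circleMap 0 1 θ))) MeasureTheory.volume 0
      (2 * Real.pi) := by
  have hm := measurable_inv_csqrt 1
  simp only [Complex.ofReal_one, one_mul] at hm
  refine intervalIntegrable_majorant.mono_fun' hm.aestronglyMeasurable ?_
  rw [Filter.EventuallyLE, MeasureTheory.ae_restrict_iff' measurableSet_uIoc]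
  filter_upwards [ae_mem_Ioo] with θ hθ hm
  have := norm_inv_csqrt_le zero_le_one le_rfl (hθ hm)
  simpa only [Complex.ofReal_one, one_mul] using this

theorem integral_circleMap_zpow (k : ℤ) :
    ∫ θ in (0 : ℝ)..2 * Real.pi, circleMap 0 1 θ ^ k = if k = 0 then 2 * (Real.pi : ℂ) else 0 := by
  split_ifs with hk
  · simp [hk]
  · have hk' : (k : ℂ) * Complex.I ≠ 0 := mul_ne_zero (by exact_mod_cast hk) Complex.I_ne_zero
    have e : ∀ θ : ℝ, circleMap 0 1 θ ^ k = Complex.exp (k * Complex.I * (θ : ℝ)) := fun θ => by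
      rw [circleMap_zero, Complex.ofReal_one, one_mul, ← Complex.exp_int_mul]
      congr 1
      ring
    simp only [e]
    rw [integral_exp_mul_complex hk']
    have e2 : (k : ℂ) * Complex.I * (2 * Real.pi : ℝ) = k * (2 * Real.pi * Complex.I) := by
      push_cast
      ring
    rw [e2, Complex.exp_int_mul_two_pi_mul_I]
    simp

theorem integral_inv_csqrt_of_lt_one {r : ℝ} (h0 : 0 ≤ r) (h1 : r < 1) (k : ℤ) :
    ∫ θ in (0 : ℝ)..2 * Real.pi, circleMap 0 1 θ ^ k *
        (1 / csqrt (1 - r * conj (circleMap 0 1 θ))) =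
      2 * (Real.pi : ℂ) * if 0 ≤ k then (invSqrtCoeff k.toNat * r ^ k.toNat : ℂ) else 0 := by
  have hconj : ∀ θ : ℝ, conj (circleMap 0 1 θ) = (circleMap 0 1 θ)⁻¹ := fun θ => by
    rw [Complex.inv_def, Complex.normSq_eq_norm_sq, norm_circleMap_zero_one]
    simp
  have hcont : ∀ k : ℤ, Continuous fun θ : ℝ => circleMap 0 1 θ ^ k := fun k =>
    (continuous_circleMap 0 1).zpow₀ k fun θ => Or.inl (circleMap_zero_one_ne_zero θ)
  have hs : Summable fun m => invSqrtCoeff m * r ^ m :=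
    (hasSum_inv_sqrt (by rwa [abs_of_nonneg h0])).summable
  have key := intervalIntegral.hasSum_integral_of_dominated_convergence
    (μ := MeasureTheory.volume) (a := 0) (b := 2 * Real.pi)
    (F := fun (m : ℕ) θ => (invSqrtCoeff m * r ^ m : ℂ) * circleMap 0 1 θ ^ (k - m))
    (f := fun θ => circleMap 0 1 θ ^ k * (1 / csqrt (1 - r * conj (circleMap 0 1 θ))))
    (fun m _ => invSqrtCoeff m * r ^ m)
    (fun m => ((hcont _).const_mul _).aestronglyMeasurable)
    (fun m => Filter.Eventually.of_forall fun θ _ => by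
      rw [norm_mul, norm_zpow, norm_circleMap_zero_one, one_zpow, mul_one, norm_mul, norm_pow,
        Complex.norm_real, Complex.norm_real, Real.norm_of_nonneg h0,
        Real.norm_of_nonneg (invSqrtCoeff_pos m).le])
    (Filter.Eventually.of_forall fun θ _ => hs)
    intervalIntegrable_const
    (Filter.Eventually.of_forall fun θ _ => by
      have h := hasSum_inv_csqrt (z := r * conj (circleMap 0 1 θ)) (by
        rw [norm_mul, Complex.norm_conj, norm_circleMap_zero_one, mul_one, Complex.norm_real,
          Real.norm_of_nonneg h0]
        exact h1)
      refine (h.mul_left (circleMap 0 1 θ ^ k)).congr_fun fun m => ?_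
      rw [hconj, mul_pow, zpow_sub₀ (circleMap_zero_one_ne_zero θ), zpow_natCast, inv_pow]
      ring)
  simp only [intervalIntegral.integral_const_mul, integral_circleMap_zpow] at key
  refine key.unique ?_
  split_ifs with hk
  · have h2 : k - (k.toNat : ℤ) = 0 := by omega
    convert hasSum_single k.toNat _ using 1
    · rw [if_pos h2]
      ring
    · intro m hm
      rw [if_neg (by omega), mul_zero]
  · convert hasSum_zero using 1
    · ext m
      rw [if_neg (by omega), mul_zero]
    · rw [mul_zero]

theorem one_sub_conj_circleMap_mem_slitPlane {θ : ℝ} (hθ : θ ∈ Set.Ioo 0 (2 * Real.pi)) :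
    1 - conj (circleMap 0 1 θ) ∈ Complex.slitPlane := by
  refine Or.inl ?_
  have hs := Real.sin_pos_of_pos_of_lt_pi (x := θ / 2) (by linarith [hθ.1]) (by linarith [hθ.2])
  have hc : Real.cos θ = 1 - 2 * Real.sin (θ / 2) ^ 2 := by
    have h1 := Real.cos_two_mul (θ / 2)
    have h2 := Real.sin_sq_add_cos_sq (θ / 2)
    rw [mul_div_cancel₀ _ two_ne_zero] at h1
    linarith
  have : (circleMap 0 1 θ).re = Real.cos θ := by
    rw [circleMap_zero, Complex.ofReal_one, one_mul, Complex.exp_ofReal_mul_I_re]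
  rw [Complex.sub_re, Complex.one_re, Complex.conj_re, this, hc]
  nlinarith

/-- Passage to the limit `r → 1` in `integral_inv_csqrt_of_lt_one`, by dominated convergence. -/
theorem circleMoment_inv_csqrt_one_sub_conj (k : ℤ) :
    circleMoment (fun ζ => 1 / csqrt (1 - conj ζ)) k =
      if 0 ≤ k then (invSqrtCoeff k.toNat : ℂ) else 0 := by
  have hcont : Continuous fun θ : ℝ => circleMap 0 1 θ ^ k :=
    (continuous_circleMap 0 1).zpow₀ k fun θ => Or.inl (circleMap_zero_one_ne_zero θ)
  have hev : ∀ᶠ r : ℝ in nhdsWithin 1 (Set.Iio 1), 0 ≤ r ∧ r < 1 := by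
    filter_upwards [self_mem_nhdsWithin,
      nhdsWithin_le_nhds (Ioi_mem_nhds (show (0 : ℝ) < 1 by norm_num))] with r h1 h2
    exact ⟨(Set.mem_Ioi.1 h2).le, h1⟩
  have hlim := intervalIntegral.tendsto_integral_filter_of_dominated_convergence
    (μ := MeasureTheory.volume) (a := 0) (b := 2 * Real.pi) (l := nhdsWithin (1 : ℝ) (Set.Iio 1))
    (F := fun (r : ℝ) θ => circleMap 0 1 θ ^ k * (1 / csqrt (1 - r * conj (circleMap 0 1 θ))))
    (f := fun θ => circleMap 0 1 θ ^ k * (1 / csqrt (1 - conj (circleMap 0 1 θ))))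
    _ (Filter.Eventually.of_forall fun r =>
      (hcont.measurable.mul (measurable_inv_csqrt r)).aestronglyMeasurable)
    (by
      filter_upwards [hev] with r hr
      filter_upwards [ae_mem_Ioo] with θ hθ hm
      rw [norm_mul, norm_zpow, norm_circleMap_zero_one, one_zpow, one_mul]
      exact norm_inv_csqrt_le hr.1 hr.2.le (hθ hm))
    intervalIntegrable_majorant
    (by
      filter_upwards [ae_mem_Ioo] with θ hθ hm
      have hs := one_sub_conj_circleMap_mem_slitPlane (hθ hm)
      have h1 : Filter.Tendsto (fun r : ℝ => 1 - r * conj (circleMap 0 1 θ))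
          (nhdsWithin 1 (Set.Iio 1)) (nhds (1 - conj (circleMap 0 1 θ))) := by
        have : Continuous fun r : ℝ => 1 - r * conj (circleMap 0 1 θ) := by fun_prop
        simpa using (this.tendsto 1).mono_left nhdsWithin_le_nhds
      have hne : csqrt (1 - conj (circleMap 0 1 θ)) ≠ 0 := by
        simp [csqrt, Complex.cpow_eq_zero_iff, Complex.slitPlane_ne_zero hs]
      exact ((tendsto_const_nhds.div (h1.cpow tendsto_const_nhds hs) hne)).const_mul _)
  have hlim2 : Filter.Tendsto (fun r : ℝ => 2 * (Real.pi : ℂ) *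
      if 0 ≤ k then (invSqrtCoeff k.toNat * r ^ k.toNat : ℂ) else 0)
      (nhdsWithin 1 (Set.Iio 1))
      (nhds (2 * (Real.pi : ℂ) * if 0 ≤ k then (invSqrtCoeff k.toNat : ℂ) else 0)) := by
    have : Continuous fun r : ℝ => 2 * (Real.pi : ℂ) *
      if 0 ≤ k then (invSqrtCoeff k.toNat * r ^ k.toNat : ℂ) else 0 := by
      split_ifs <;> fun_prop
    simpa using (this.tendsto 1).mono_left nhdsWithin_le_nhds
  have h := tendsto_nhds_unique (hlim.congr' (by
    filter_upwards [hev] with r hr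
    exact integral_inv_csqrt_of_lt_one hr.1 hr.2 k)) hlim2
  have hpi : (2 * (Real.pi : ℂ)) ≠ 0 :=
    mul_ne_zero two_ne_zero (by exact_mod_cast Real.pi_ne_zero)
  rw [circleMoment, h, inv_mul_cancel_left₀ hpi]

/-! ### Identification of the operators -/

namespace HardySobolev

theorem toeplitzEquiv_eval (f : HardySobolevZero) {z : ℂ} (hz : ‖z‖ < 1) :
    (toeplitzEquiv f) z = Pplus (fun ζ => (f : HardySobolev (3 / 4)) ζ / csqrt (-ζ)) z := by
  have h := hasSum_Pplus (Φ := fun ζ => 1 / csqrt (-ζ)) intervalIntegrable_inv_csqrt_neg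
    (f : HardySobolev (3 / 4)) (C := fun j => ((toeplitzEquiv f).coeff j : ℂ)) (fun j => ?_) hz
  · simp only [mul_one_div] at h
    exact ((toeplitzEquiv f).hasSum_of_norm_le_one hz.le).unique h
  · have h := Complex.hasSum_ofReal.2 (hasSum_coeff_reducedToeplitzOp f.2 j)
    rw [toeplitzEquiv_apply]
    refine h.congr_fun fun n => ?_
    rw [circleMoment_inv_csqrt_neg]
    push_cast
    ring_nf

/-- The Taylor coefficients of `P₊[g / √(1 - conj ζ)]`. -/
noncomputable def spectralData (g : HardySobolev (3 / 4)) (j : ℕ) : ℝ :=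
  ∑' n, g.coeff n * if j ≤ n then invSqrtCoeff (n - j) else 0

theorem invSqrtCoeff_le_one (n : ℕ) : invSqrtCoeff n ≤ 1 := by
  have h := invSqrtCoeff_mul_sq_le n
  have h1 : 1 ≤ quarticRoot n := quarticRoot_zero ▸ quarticRoot_mono n.zero_le
  nlinarith [invSqrtCoeff_pos n, one_le_pow₀ h1 (n := 2)]

theorem hasSum_spectralData (g : HardySobolev (3 / 4)) (j : ℕ) :
    HasSum (fun n => g.coeff n * if j ≤ n then invSqrtCoeff (n - j) else 0)
      (spectralData g j) := by
  refine Summable.hasSum (Summable.of_norm_bounded g.summable_abs_coeff fun n => ?_)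
  rw [norm_mul, Real.norm_eq_abs]
  refine mul_le_of_le_one_right (abs_nonneg _) ?_
  split_ifs
  · rw [Real.norm_of_nonneg (invSqrtCoeff_pos _).le]
    exact invSqrtCoeff_le_one _
  · simp

theorem isGeneratingFunction_spectralData (g : HardySobolev (3 / 4)) :
    IsGeneratingFunction (spectralData g) (Pplus fun ζ => g ζ / csqrt (1 - conj ζ)) := by
  intro z hz
  have h := hasSum_Pplus (Φ := fun ζ => 1 / csqrt (1 - conj ζ))
    intervalIntegrable_inv_csqrt_one_sub_conj g (C := fun j => (spectralData g j : ℂ))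
    (fun j => ?_) hz
  · simpa only [mul_one_div] using h
  · refine (Complex.hasSum_ofReal.2 (hasSum_spectralData g j)).congr_fun fun n => ?_
    rw [circleMoment_inv_csqrt_one_sub_conj]
    rcases le_or_gt j n with h | h
    · rw [if_pos h, if_pos (by omega), show ((n : ℤ) - j).toNat = n - j by omega]
      push_cast
      rfl
    · rw [if_neg (by omega), if_neg (by omega)]
      simp

/-- The factorization of the inverse matrix into a lower triangular Toeplitz matrix of symbol
`√(1 - z)` and an upper triangular one of symbol `1 / √(1 - conj ζ)`. -/
theorem inverseToeplitz_eq_sum (m n : ℕ) : inverseToeplitz m n =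
    ∑ j ∈ Finset.range (m + 1),
      sqrtCoeff (m - j) * if j ≤ n then invSqrtCoeff (n - j) else 0 := by
  induction m generalizing n with
  | zero =>
    have : (n : ℝ) + 1 / 2 ≠ 0 := by positivity
    simp [inverseToeplitz, sqrtCoeff, invSqrtCoeff_zero]
    field_simp
  | succ m ih =>
    -- Both sides satisfy `B_{m+1,n+1} - B_{m,n} = sqrtCoeff (m+1) * invSqrtCoeff (n+1)`.
    rw [Finset.sum_range_succ']
    cases n with
    | zero =>
      have h1 := one_sub_two_mul_ne_zero (m + 1)
      rw [Finset.sum_eq_zero fun j _ => by rw [if_neg (by omega), mul_zero]]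
      simp only [inverseToeplitz, sqrtCoeff, invSqrtCoeff_zero, le_refl, if_true, Nat.sub_zero]
      have e : ((0 : ℕ) : ℝ) - (m + 1 : ℕ) + 1 / 2 = (1 - 2 * (m + 1 : ℕ)) / 2 := by
        push_cast
        ring
      rw [e, one_div_div]
      push_cast
      ring
    | succ n =>
      simp only [Nat.add_sub_add_right, Nat.add_le_add_iff_right]
      rw [← ih n, if_pos (Nat.zero_le _), Nat.sub_zero, Nat.sub_zero]
      have hm := invSqrtCoeff_succ m
      have hn := invSqrtCoeff_succ n
      have h0 := half_integer_ne_zero n m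
      have e : ((n + 1 : ℕ) : ℝ) - (m + 1 : ℕ) + 1 / 2 = n - m + 1 / 2 := by push_cast; ring
      have h1 : (1 : ℝ) - 2 * (m + 1 : ℕ) = -(2 * (m + 1 / 2)) := by push_cast; ring
      have h2 : (m : ℝ) + 1 / 2 ≠ 0 := by positivity
      have hm' : invSqrtCoeff m = ((m : ℝ) + 1) * invSqrtCoeff (m + 1) / (m + 1 / 2) := by
        rw [hm, mul_div_cancel_left₀ _ h2]
      rw [inverseToeplitz, inverseToeplitz, e, sqrtCoeff, h1, mul_comm (invSqrtCoeff n), ← hn, hm']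
      push_cast
      generalize invSqrtCoeff (m + 1) = u
      generalize invSqrtCoeff (n + 1) = v
      have h3 : ((n : ℝ) - m + 1 / 2) * (1 / ((n : ℝ) - m + 1 / 2)) = 1 := mul_one_div_cancel h0
      generalize 1 / ((n : ℝ) - m + 1 / 2) = w at h3
      field_simp
      linear_combination (-2 * u * v) * h3

theorem coeff_inverseToeplitzOp (g : HardySobolev (3 / 4)) (m : ℕ) :
    (inverseToeplitzOp g).coeff m =
      ∑ j ∈ Finset.range (m + 1), spectralData g j * sqrtCoeff (m - j) := by
  rw [inverseToeplitzOp, coeff_matrixOp]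
  refine HasSum.tsum_eq ?_
  have h := hasSum_sum (s := Finset.range (m + 1)) fun j _ =>
    (hasSum_spectralData g j).mul_right (sqrtCoeff (m - j))
  refine h.congr_fun fun n => ?_
  rw [inverseToeplitz_eq_sum, Finset.sum_mul]
  exact Finset.sum_congr rfl fun j _ => by ring

theorem inverseToeplitzOp_eval (g : HardySobolev (3 / 4)) {z : ℂ} (hz : ‖z‖ < 1) :
    (inverseToeplitzOp g) z =
      Pplus (fun ζ => g ζ / csqrt (1 - conj ζ)) z * csqrt (1 - z) := by
  have h1 := isGeneratingFunction_spectralData g z hz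
  have h2 := hasSum_csqrt hz
  have h3 := hasSum_sum_range_mul_of_summable_norm h1.summable.norm h2.summable.norm
  rw [h1.tsum_eq, h2.tsum_eq] at h3
  refine ((inverseToeplitzOp g).hasSum_of_norm_le_one hz.le).unique (h3.congr_fun fun m => ?_)
  rw [coeff_inverseToeplitzOp, Complex.ofReal_sum, Finset.sum_mul]
  refine Finset.sum_congr rfl fun j hj => ?_
  have : z ^ m = z ^ j * z ^ (m - j) := by
    rw [← pow_add]
    congr 1
    have := Finset.mem_range.1 hj
    omega
  rw [this]
  push_cast
  ring

theorem csqrt_one_sub_ne_zero {z : ℂ} (hz : ‖z‖ < 1) : csqrt (1 - z) ≠ 0 := by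
  have hz1 : 1 - z ≠ 0 := by
    intro h0
    rw [← sub_eq_zero.1 h0] at hz
    simp at hz
  simp [csqrt, Complex.cpow_eq_zero_iff, hz1]

theorem Pplus_eq_inverseToeplitzOp_div (g : HardySobolev (3 / 4)) {z : ℂ} (hz : ‖z‖ < 1) :
    Pplus (fun ζ => g ζ / csqrt (1 - conj ζ)) z = (inverseToeplitzOp g) z / csqrt (1 - z) := by
  rw [inverseToeplitzOp_eval g hz, mul_div_cancel_right₀ _ (csqrt_one_sub_ne_zero hz)]

theorem isGeneratingFunction_iff (g : HardySobolev (3 / 4)) (h : ℕ → ℝ) :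
    IsGeneratingFunction h (Pplus fun ζ => g ζ / csqrt (1 - conj ζ)) ↔
      IsGeneratingFunction h fun z => (inverseToeplitzOp g) z / csqrt (1 - z) :=
  forall₂_congr fun z hz => by rw [Pplus_eq_inverseToeplitzOp_div g hz]

end HardySobolev

open HardySobolev in
theorem corollary4p2 :
    (∃ A : HardySobolevZero ≃L[ℝ] HardySobolev (3 / 4),
      ∀ f : HardySobolevZero, ∀ z : ℂ, ‖z‖ < 1 →
        (A f) z = Pplus (fun ζ => (f : HardySobolev (3 / 4)) ζ / csqrt (-ζ)) z) ∧
    calH0 = {h : ℕ → ℝ | ∃ g : HardySobolev (3 / 4),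
      IsGeneratingFunction h (Pplus fun ζ => g ζ / csqrt (1 - conj ζ))} ∧
    (∃ C₁ C₂ : ℝ, 0 < C₁ ∧ 0 < C₂ ∧ ∀ g : HardySobolev (3 / 4), ∃ h : calH,
      IsGeneratingFunction h (Pplus fun ζ => g ζ / csqrt (1 - conj ζ)) ∧
        C₁ * ‖g‖ ≤ calH.norm h ∧ calH.norm h ≤ C₂ * ‖g‖) := by
  refine ⟨⟨toeplitzEquiv, fun f z hz => toeplitzEquiv_eval f hz⟩, ?_, ?_⟩
  · ext h
    constructor
    · rintro ⟨hh, h1⟩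
      refine ⟨toeplitzEquiv ⟨calH.numerator ⟨h, hh⟩, h1⟩, ?_⟩
      rw [isGeneratingFunction_iff, ← coe_toeplitzEquiv_symm_apply,
        ContinuousLinearEquiv.symm_apply_apply]
      exact Classical.choose_spec hh
    · rintro ⟨g, hg⟩
      rw [isGeneratingFunction_iff] at hg
      have hmem : h ∈ calH := ⟨inverseToeplitzOp g, hg⟩
      refine ⟨hmem, ?_⟩
      rw [calH.numerator_eq ⟨h, hmem⟩ (inverseToeplitzOp g) hg]
      exact inverseToeplitzOp_mem g
  · refine ⟨1 / (‖reducedToeplitzOp‖ + 1), ‖inverseToeplitzOp‖ + 1, by positivity, by positivity,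
      fun g => ?_⟩
    have hg := (isGeneratingFunction_iff g _).1 (isGeneratingFunction_spectralData g)
    have hmem : spectralData g ∈ calH := ⟨inverseToeplitzOp g, hg⟩
    have hnorm : calH.norm ⟨spectralData g, hmem⟩ = ‖inverseToeplitzOp g‖ :=
      congrArg (fun f => ‖f‖)
        (calH.numerator_eq ⟨spectralData g, hmem⟩ (inverseToeplitzOp g) hg)
    have h1 := reducedToeplitzOp.le_opNorm (inverseToeplitzOp g)
    have h2 : reducedToeplitzOp (inverseToeplitzOp g) = g :=
      DFunLike.congr_fun reducedToeplitzOp_comp_inverseToeplitzOp g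
    rw [h2] at h1
    refine ⟨⟨spectralData g, hmem⟩, isGeneratingFunction_spectralData g, ?_, ?_⟩
    · rw [hnorm, one_div_mul_eq_div, div_le_iff₀ (by positivity)]
      linarith [norm_nonneg (inverseToeplitzOp g)]
    · rw [hnorm]
      linarith [inverseToeplitzOp.le_opNorm g, norm_nonneg g]
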